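/- Let $E$ be an elliptic curve over a finite field $k$. For a finite extension $k'$ of $k$ and a divisor $D$ on $E$ over $k'$ let $\mathcal L(D)=\{f\in k'(E) : f=0 \text{ or } \operatorname{div}(f)+D\ge 0\}$. For a finite set $\Sigma\subset E(k')$ disjoint from the support of $D$ and a point $P\in\Sigma$ put $\Sigma^*=\Sigma\setminus\{P\}$ and $\mathcal L_0(D)=\{f\in\mathcal L(D) : f(P)=0\}$, and let $\mathcal C^0_L(D,\Sigma^*)$ be the evaluation map $e^*:\mathcal L_0(D)\to (k')^{\Sigma^*}$, $f\mapsto (f(s))_{s\in\Sigma^*}$. A code, that is, an injective linear map $e:C\to (k')^T$ with $T$ finite, is called MDS if the minimal weight $d$ of a non-zero code word satisfies $d=|T|-\dim C+1$; the zero code $C=0$ counts as MDS. A decomposition $C=\bigoplus_i C_i$ of the source of an MDS code $e$ is called proper if the restriction of $e$ to each $C_i$ is MDS. For a finite set $Y$ of rational points write $(Y)=\sum_{y\in Y}y$ for the corresponding divisor. Theorem 2.1. Let $\{X_i\}_{i\in I}$ be a finite non-empty family of subsets of $E(k)$ that meet in a single point, i.e. there is a point $Q\in E(k)$ such that $Q\in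 X_i$ for all $i$ and $X_i\cap X_j=\{Q\}$ for all $i\ne j$. Let $X=\bigcup_i X_i$ and let $m$ be an integer with $m>|X|$. Then there are a finite extension $k'$ of $k$ and a subset $\Sigma$ of $E(k')\setminus X$ such that the following hold. 1. $|\Sigma|=m$. 2. For every choice of $P\in\Sigma$, the map $e^*$ is an injective linear map on $\mathcal L_0((X))$ and on each $\mathcal L_0((X_i))$, and $\mathcal C^0_L((X),\Sigma^*)$ and all $\mathcal C^0_L((X_i),\Sigma^*)$ are MDS. 3. For every choice of $P\in\Sigma$, each $\mathcal L_0((X_i))$ is a subspace of $\mathcal L_0((X))$, there is a direct sum decomposition $\mathcal L_0((X))=\bigoplus_i \mathcal L_0((X_i))$, and this decomposition is proper. -/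

import Mathlib

universe u w

open scoped WithZero

noncomputable section

namespace EllipticGoppa

/-! ### Codes -/

/-- A code: an injective linear map `e : C → K ^ T` from a `K`-vector space `C`, where `T` is the
finite set of coordinates. -/
structure IsCode {K C T : Type*} [Field K] [AddCommGroup C] [Module K C] (e : C → T → K) :
    Prop where
  linear : IsLinearMap K e
  injective : Function.Injective e

open Classical in
/-- The weights (numbers of non-zero coordinates) of the non-zero code words of `e`. -/
def weights {K C T : Type*} [Field K] [Fintype T] (e : C → T → K) : Set ℕ :=
  {w | ∃ x ∈ Set.range e, x ≠ 0 ∧ w = hammingNorm x}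

/-- A code of length `N = |T|` is MDS if its minimal distance `d` (the least weight of a non-zero
code word) attains the Singleton bound: `d = N - dim C + 1`. The zero code, which has no non-zero
code word, is MDS by convention. -/
structure IsMDS {K C T : Type*} [Field K] [AddCommGroup C] [Module K C] [Fintype T]
    (e : C → T → K) : Prop where
  isCode : IsCode e
  singleton_eq : Nontrivial C →
    ∃ d : ℕ, IsLeast (weights e) d ∧ d + Module.finrank K C = Fintype.card T + 1

open Classical in
/-- A decomposition `C = ⊕ i, A i` of (the source of) an MDS code `e` is proper if the restriction
of `e` to every factor `A i` is again MDS. -/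
structure IsProperDecomposition {K C T ι : Type*} [Field K] [AddCommGroup C] [Module K C]
    [Fintype T] (e : C → T → K) (A : ι → Submodule K C) : Prop where
  isMDS : IsMDS e
  isInternal : DirectSum.IsInternal A
  isMDS_factor : ∀ i, IsMDS (fun x : A i => e x)

/-! ### Closed points of a curve -/

/-- The closed points of the smooth projective curve over `K` with function field `F`:
the discrete valuation rings of `F` that contain `K` and have fraction field `F`. -/
structure ClosedPoint (K F : Type*) [Field K] [Field F] [Algebra K F] where
  ring : ValuationSubring F
  algebraMap_mem : ∀ c : K, algebraMap K F c ∈ ring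
  isDVR : IsDiscreteValuationRing ring

/-- The normalised discrete valuation at a closed point `v`, written multiplicatively:
`v.valuation f = exp (-ord_v f)` for `f ≠ 0`, and `v.valuation 0 = 0`. -/
def ClosedPoint.valuation {K F : Type*} [Field K] [Field F] [Algebra K F]
    (v : ClosedPoint K F) : Valuation F ℤᵐ⁰ :=
  haveI := v.isDVR
  (IsDiscreteValuationRing.maximalIdeal v.ring).valuation F

theorem ClosedPoint.valuation_algebraMap_le_one {K F : Type*} [Field K] [Field F] [Algebra K F]
    (v : ClosedPoint K F) (c : K) : v.valuation (algebraMap K F c) ≤ 1 :=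
  haveI := v.isDVR
  (IsDiscreteValuationRing.maximalIdeal v.ring).valuation_le_one (K := F)
    (⟨algebraMap K F c, v.algebraMap_mem c⟩ : v.ring)

/-- A divisor, given by its coefficients at the closed points. -/
abbrev Divisor (K F : Type*) [Field K] [Field F] [Algebra K F] : Type _ := ClosedPoint K F → ℤ

/-- The space `L(D)` of the rational functions `f` with `f = 0` or `div f + D ≥ 0`, that is,
`ord_v f + D v ≥ 0` for every closed point `v`. -/
def riemannRochSpace {K F : Type*} [Field K] [Field F] [Algebra K F] (D : Divisor K F) :
    Submodule K F where
  carrier := {f | ∀ v : ClosedPoint K F, v.valuation f ≤ WithZero.exp (D v)}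
  add_mem' hf hg v := (v.valuation.map_add _ _).trans (max_le (hf v) (hg v))
  zero_mem' v := by simp
  smul_mem' c f hf v := by
    rw [Algebra.smul_def, map_mul]
    exact (mul_le_of_le_one_left' (v.valuation_algebraMap_le_one c)).trans (hf v)

/-! ### Elliptic curves -/

section Elliptic

variable {K : Type*} [Field K] {E : WeierstrassCurve K}

/-- The coordinate function `x` in the function field of `E`. -/
def xFun (E : WeierstrassCurve K) : E.toAffine.FunctionField :=
  algebraMap E.toAffine.CoordinateRing _
    (WeierstrassCurve.Affine.CoordinateRing.mk E.toAffine (Polynomial.C Polynomial.X))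

/-- The coordinate function `y` in the function field of `E`. -/
def yFun (E : WeierstrassCurve K) : E.toAffine.FunctionField :=
  algebraMap E.toAffine.CoordinateRing _
    (WeierstrassCurve.Affine.CoordinateRing.mk E.toAffine Polynomial.X)

/-- `IsAt v P`: the closed point `v` is the rational point `P`. For `P = (a, b)` this says that
`x - a` and `y - b` vanish at `v`, for the point `P` at infinity that `x` has a pole at `v`. -/
def IsAt (v : ClosedPoint K E.toAffine.FunctionField) : E.toAffine.Point → Prop
  | .zero => 1 < v.valuation (xFun E)
  | .some a b _ => v.valuation (xFun E - algebraMap K _ a) < 1 ∧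
      v.valuation (yFun E - algebraMap K _ b) < 1

/-- The divisor `(X) = ∑ x ∈ X, x` of a set `X` of rational points. -/
def pointsDivisor (X : Set E.toAffine.Point) : Divisor K E.toAffine.FunctionField :=
  fun v => ({x ∈ X | IsAt v x}.ncard : ℤ)

/-- The rational function `f` is regular at the rational point `P` and has the value `c` there:
`f - c` lies in the maximal ideal of the local ring at `P`. -/
def HasValueAt (P : E.toAffine.Point) (f : E.toAffine.FunctionField) (c : K) : Prop :=
  ∀ v : ClosedPoint K E.toAffine.FunctionField, IsAt v P →
    v.valuation (f - algebraMap K _ c) < 1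

open Classical in
/-- The value `f(P)` of a rational function at a rational point where it is regular
(and `0` if it is not regular there). -/
def valueAt (P : E.toAffine.Point) (f : E.toAffine.FunctionField) : K :=
  if h : ∃ c, HasValueAt P f c then h.choose else 0

/-- The subspace `L₀(D)` of the functions in `L(D)` that vanish at `P`. -/
def L0 (D : Divisor K E.toAffine.FunctionField) (P : E.toAffine.Point) :
    Submodule K E.toAffine.FunctionField where
  carrier := {f | f ∈ riemannRochSpace D ∧ HasValueAt P f 0}
  add_mem' := by
    rintro f g ⟨hf, hf'⟩ ⟨hg, hg'⟩
    refine ⟨add_mem hf hg, fun v hv => ?_⟩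
    have h1 := hf' v hv
    have h2 := hg' v hv
    rw [map_zero, sub_zero] at h1 h2 ⊢
    exact v.valuation.map_add_lt h1 h2
  zero_mem' := ⟨zero_mem _, fun v _ => by simp⟩
  smul_mem' := by
    rintro c f ⟨hf, hf'⟩
    refine ⟨Submodule.smul_mem _ c hf, fun v hv => ?_⟩
    have h1 := hf' v hv
    rw [map_zero, sub_zero] at h1 ⊢
    rw [Algebra.smul_def, map_mul]
    exact (mul_le_of_le_one_left' (v.valuation_algebraMap_le_one c)).trans_lt h1

open Classical in
/-- `Σ* = Σ \ {P}`. -/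
def punctured (S : Finset E.toAffine.Point) (P : E.toAffine.Point) : Finset E.toAffine.Point :=
  S.erase P

/-- The evaluation map `e* : L₀(D) → K ^ Σ*`, `f ↦ (f(s))_{s ∈ Σ*}`, which is the code
`C⁰_L(D, Σ*)`. -/
def code (D : Divisor K E.toAffine.FunctionField) (S : Finset E.toAffine.Point)
    (P : E.toAffine.Point) : L0 D P → punctured S P → K :=
  fun f s => valueAt (s : E.toAffine.Point) (f : E.toAffine.FunctionField)

/-- The inclusion `E(K) ⊆ E(K')` of the rational points for a field extension `K'` of `K`. -/
def inclusion (E : WeierstrassCurve K) (K' : Type*) [Field K'] [Algebra K K'] :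
    E.toAffine.Point → (E.map (algebraMap K K')).toAffine.Point
  | .zero => .zero
  | .some a b h => .some (algebraMap K K' a) (algebraMap K K' b)
      ((E.toAffine.map_nonsingular (algebraMap K K').injective a b).mpr h)

end Elliptic

end EllipticGoppa

end

open EllipticGoppa

/-! Let `Y` be a finite set of rational points containing `Q`, and let `P ∉ Y`. For each `A ∈ Y \
{Q}` there is an explicit function with simple poles at `A` and `Q`, no other poles, and a zero at
`P` (`basisFun`). These functions form a basis of `L₀((Y))` (`linearIndepOn_basisFun`,
`L0_eq_span`), so its dimension is `|Y| - 1` (`finrank_L0`). The function attached to `A` depends on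
`A`, `Q` and `P` but not on `Y`. Since `X \ {Q}` is the disjoint union of the sets `X_i \ {Q}`, the
basis of `L₀((X))` is the disjoint union of the bases of the `L₀((X_i))`, and this is the direct sum
decomposition (`isInternal_L0`).

The MDS property comes from Abel's theorem (`sum_eq_sum_of_vanish`): if a non-zero function in
`L((Y))` vanishes on a set `Z` disjoint from `Y` with `|Z| = |Y|`, then `Z` and `Y` have the same
sum in the group. Suppose therefore that `S` is disjoint from `Y` and that no subset of `S` of size
`|Y|` has the sum of `Y` (`IsGeneric`). A non-zero element of `L₀((Y))` already vanishes at `P ∈ S`,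
so it has at most `|Y| - 2` zeros in `S \ {P}`, fewer than the dimension. This is equality in the
Singleton bound (`isMDS_of_card_zeros_lt`). A set `S` that is generic for `X` and all `X_i` at once
is chosen point by point. The number of forbidden points is bounded independently of the field
(`exists_generic_finset`), while the number of points of `E` over finite extensions is not
(`exists_extension_card_lt`).

For Abel's theorem, `f` is multiplied by the product of all `x - x(A)` with `A ∈ X`. The result is
an element `r` of the affine coordinate ring that vanishes on `Z` and on `-X`. The degree of its
norm to `K[X]` is its pole order at infinity, and this is so small that `r` generates the product of
the corresponding point ideals (`span_eq_prod_ptIdeal`). That product therefore has trivial class,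
and the injectivity of the map from points to ideal classes gives the equation of sums. The argument
needs the coordinate ring to be a Dedekind domain, and it needs the closed points at rational points
to be identified with the primes of this ring and the valuation at infinity (`isAt_iff`). -/

noncomputable section

namespace EllipticGoppa

open Polynomial WeierstrassCurve IsDedekindDomain

/-! ### Coordinate ring: conjugation, norm, and the Dedekind property. -/

section CoordinateRing

variable {K : Type*} [Field K] {W : WeierstrassCurve K}

/-- The linear polynomial `a₁ X + a₃`. -/
def linPoly (W : WeierstrassCurve K) : K[X] := C W.a₁ * X + C W.a₃

/-- The cubic polynomial `X³ + a₂ X² + a₄ X + a₆`. -/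
def cubicPoly (W : WeierstrassCurve K) : K[X] := X ^ 3 + C W.a₂ * X ^ 2 + C W.a₄ * X + C W.a₆

/-- The class of `Y` in the coordinate ring. -/
def yClass (W : WeierstrassCurve K) : W.toAffine.CoordinateRing :=
  Affine.CoordinateRing.mk W.toAffine X

/-- The class of a polynomial in `X` in the coordinate ring. -/
abbrev xPoly (W : WeierstrassCurve K) (p : K[X]) : W.toAffine.CoordinateRing :=
  algebraMap K[X] W.toAffine.CoordinateRing p

theorem xPoly_injective : Function.Injective (xPoly W) :=
  FaithfulSMul.algebraMap_injective K[X] W.toAffine.CoordinateRing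

theorem exists_eq_add_mul_yClass (r : W.toAffine.CoordinateRing) :
    ∃ p q : K[X], r = xPoly W p + xPoly W q * yClass W := by
  obtain ⟨p, q, h⟩ := Affine.CoordinateRing.exists_smul_basis_eq r
  exact ⟨p, q, by rw [← h, Algebra.smul_def, Algebra.smul_def, mul_one]; rfl⟩

theorem yClass_sq : yClass W ^ 2 = xPoly W (cubicPoly W) - xPoly W (linPoly W) * yClass W := by
  have h := Affine.CoordinateRing.smul_basis_mul_Y (W' := W.toAffine) 0 1
  simp only [Algebra.smul_def, map_zero, map_one, one_mul, zero_add, mul_one,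
    zero_sub] at h
  rw [sq]
  refine h.trans ?_
  rw [map_neg, neg_mul, ← sub_eq_add_neg]
  rfl

theorem norm_add_mul_yClass (p q : K[X]) :
    Algebra.norm K[X] (xPoly W p + xPoly W q * yClass W) =
      p ^ 2 - p * q * linPoly W - q ^ 2 * cubicPoly W := by
  have h := Affine.CoordinateRing.norm_smul_basis (W' := W.toAffine) p q
  rw [Algebra.smul_def, Algebra.smul_def, mul_one] at h
  exact h

theorem degree_norm_add_mul_yClass (p q : K[X]) :
    (Algebra.norm K[X] (xPoly W p + xPoly W q * yClass W)).degree =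
      max (2 • p.degree) (2 • q.degree + 3) := by
  have h := Affine.CoordinateRing.degree_norm_smul_basis (W' := W.toAffine) p q
  rw [Algebra.smul_def, Algebra.smul_def, mul_one] at h
  exact h

/-- The involution `y ↦ -y - a₁ x - a₃` of the coordinate ring. -/
def conj (W : WeierstrassCurve K) :
    W.toAffine.CoordinateRing →ₐ[K[X]] W.toAffine.CoordinateRing :=
  AdjoinRoot.liftAlgHom W.toAffine.polynomial (Algebra.ofId K[X] W.toAffine.CoordinateRing)
    (-yClass W - xPoly W (linPoly W)) <| by
      have h := yClass_sq (W := W)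
      have e : eval₂ (↑(Algebra.ofId K[X] W.toAffine.CoordinateRing))
          (-yClass W - xPoly W (linPoly W)) W.toAffine.polynomial =
          (-yClass W - xPoly W (linPoly W)) ^ 2 +
            xPoly W (linPoly W) * (-yClass W - xPoly W (linPoly W)) - xPoly W (cubicPoly W) := by
        simp only [Affine.polynomial, eval₂_sub, eval₂_add, eval₂_mul, eval₂_pow, eval₂_X, eval₂_C]
        rfl
      rw [e]
      linear_combination h

theorem conj_yClass : conj W (yClass W) = -yClass W - xPoly W (linPoly W) :=
  AdjoinRoot.liftAlgHom_root ..

theorem conj_xPoly (p : K[X]) : conj W (xPoly W p) = xPoly W p := (conj W).commutes p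

theorem conj_conj (r : W.toAffine.CoordinateRing) : conj W (conj W r) = r := by
  obtain ⟨p, q, rfl⟩ := exists_eq_add_mul_yClass r
  simp only [map_add, map_mul, conj_xPoly, conj_yClass, map_sub, map_neg]
  ring

/-- The norm of a quadratic extension is the product of the two conjugates. This identity makes
denominators polynomial and later compares an ideal with its conjugate. -/
theorem mul_conj (r : W.toAffine.CoordinateRing) :
    r * conj W r = xPoly W (Algebra.norm K[X] r) := by
  obtain ⟨p, q, rfl⟩ := exists_eq_add_mul_yClass r
  rw [norm_add_mul_yClass]
  simp only [map_add, map_mul, conj_xPoly, conj_yClass, map_sub, map_pow]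
  linear_combination (-xPoly W q ^ 2) * yClass_sq (W := W)

theorem conj_ne_zero {r : W.toAffine.CoordinateRing} (h : r ≠ 0) : conj W r ≠ 0 := by
  intro h0
  apply h
  rw [← conj_conj r, h0, map_zero]

theorem norm_ne_zero {r : W.toAffine.CoordinateRing} (h : r ≠ 0) :
    Algebra.norm K[X] r ≠ 0 := by
  intro h0
  have := mul_conj r
  rw [h0, xPoly, map_zero] at this
  exact mul_ne_zero h (conj_ne_zero h) this

/-- The involution of the coordinate ring as an automorphism. -/
def conjEquiv (W : WeierstrassCurve K) :
    W.toAffine.CoordinateRing ≃ₐ[K[X]] W.toAffine.CoordinateRing :=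
  AlgEquiv.ofAlgHom (conj W) (conj W) (AlgHom.ext conj_conj) (AlgHom.ext conj_conj)

instance : Module.Finite K[X] W.toAffine.CoordinateRing :=
  Module.Finite.of_basis (Affine.CoordinateRing.basis W.toAffine)

/-! ### The coordinate ring of an elliptic curve is a Dedekind domain -/

/-- A prime `π` of `K[X]` such that `π²` divides `N(p + q y)` and `π` divides `Tr(p + q y)` also
divides `p` and `q`: otherwise `(x, -p / q)` modulo `π` would be a singular point. -/
theorem dvd_of_dvd_trace_of_sq_dvd_norm [W.IsElliptic] {π p q : K[X]} (hπ : Prime π)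
    (htr : π ∣ 2 * p - q * linPoly W)
    (hnorm : π ^ 2 ∣ p ^ 2 - p * q * linPoly W - q ^ 2 * cubicPoly W) : π ∣ p ∧ π ∣ q := by
  have hq : π ∣ q := by
    by_contra hq
    have hcop : IsCoprime (π ^ 2) q :=
      ((hπ.irreducible.coprime_iff_not_dvd).mpr hq).pow_left
    obtain ⟨a, s, hs⟩ := hcop
    -- `z = - p / q` modulo `π ^ 2`
    set z : K[X] := -(p * s) with hz
    have hw : π ^ 2 ∣ z ^ 2 + z * linPoly W - cubicPoly W := by
      have : z ^ 2 + z * linPoly W - cubicPoly W =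
          s ^ 2 * (p ^ 2 - p * q * linPoly W - q ^ 2 * cubicPoly W) +
          (a * π ^ 2) * (-(p * s * linPoly W) - cubicPoly W * (1 + s * q)) := by
        rw [hz]
        linear_combination (p * s * linPoly W + cubicPoly W * (1 + s * q)) * hs
      rw [this]
      exact dvd_add (hnorm.mul_left _) ((dvd_mul_left _ _).mul_right _)
    have hwy : π ∣ 2 * z + linPoly W := by
      have : 2 * z + linPoly W = -s * (2 * p - q * linPoly W) +
          π * (a * π * linPoly W) := by
        rw [hz]
        linear_combination (-linPoly W) * hs
      rw [this]
      exact dvd_add (htr.mul_left _) (dvd_mul_right _ _)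
    -- The Weierstrass congruence holds modulo `π ^ 2`, so its derivative with respect to `X` holds
    -- modulo `π`. The terms containing `derivative z` form a multiple of `2 z + linPoly W`, which
    -- `π` divides.
    have hwx : π ∣ C W.a₁ * z - (3 * X ^ 2 + 2 * C W.a₂ * X + C W.a₄) := by
      obtain ⟨g, hg⟩ := hw
      have hd := congrArg derivative hg
      simp only [cubicPoly, linPoly, derivative_mul, derivative_pow, derivative_sub, derivative_add,
        derivative_C, derivative_X] at hd
      norm_num at hd
      have : C W.a₁ * z - (3 * X ^ 2 + 2 * C W.a₂ * X + C W.a₄) =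
          π * (2 * derivative π * g + π * derivative g) - derivative z * (2 * z + linPoly W) := by
        rw [linPoly]
        have c3 : (C 3 : K[X]) = 3 := map_ofNat C 3
        have c2 : (C 2 : K[X]) = 2 := map_ofNat C 2
        simp only [c3, c2] at hd
        linear_combination hd
      rw [this]
      exact dvd_sub (dvd_mul_right _ _) (hwy.mul_left _)
    have : Fact (Irreducible π) := ⟨hπ.irreducible⟩
    let φ : K →+* AdjoinRoot π := algebraMap K (AdjoinRoot π)
    have key : ∀ f : K[X], π ∣ f → AdjoinRoot.mk π f = 0 := fun f hf => AdjoinRoot.mk_eq_zero.mpr hf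
    have hφ : ∀ c, AdjoinRoot.mk π (C c) = φ c := fun c => rfl
    have e0 := key _ ((dvd_pow_self π two_ne_zero).trans hw)
    have e1 := key _ hwy
    have e2 := key _ hwx
    simp only [cubicPoly, linPoly, map_add, map_sub, map_mul, map_pow, hφ, map_ofNat] at e0 e1 e2
    set x' := AdjoinRoot.mk π X
    set z' := AdjoinRoot.mk π z
    -- Over the field `K[X] / π` the pair `(x', z')` lies on the curve and both partial derivatives
    -- vanish there, which is impossible on an elliptic curve.
    have heq : (W.map φ).toAffine.Equation x' z' := by
      rw [Affine.equation_iff]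
      simp only [map_a₁, map_a₂, map_a₃, map_a₄, map_a₆]
      linear_combination e0
    have hns := (Affine.equation_iff_nonsingular (W := (W.map φ).toAffine)).mp heq
    rw [Affine.nonsingular_iff'] at hns
    simp only [map_a₁, map_a₂, map_a₃, map_a₄] at hns
    rcases hns.2 with h | h
    · exact h e2
    · exact h (by linear_combination e1)
  refine ⟨hπ.dvd_of_dvd_pow (n := 2) ?_, hq⟩
  have : p ^ 2 = (p ^ 2 - p * q * linPoly W - q ^ 2 * cubicPoly W) +
      q * (p * linPoly W + q * cubicPoly W) := by ring
  rw [this]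
  exact dvd_add ((dvd_pow_self π two_ne_zero).trans hnorm) (hq.mul_right _)

/-- A quotient of elements of an integrally closed domain that is integral in some field extension
is an element of the domain. -/
theorem dvd_of_isIntegral_of_mul_eq {A L : Type*} [CommRing A] [IsDomain A] [IsIntegrallyClosed A]
    [Field L] [Algebra A L] (hinj : Function.Injective (algebraMap A L)) {d s : A} (hd : d ≠ 0)
    {f : L} (hf : IsIntegral A f) (h : algebraMap A L d * f = algebraMap A L s) : d ∣ s := by
  let g : FractionRing A →ₐ[A] L := IsFractionRing.liftAlgHom (g := Algebra.ofId A L) hinj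
  have hd' : algebraMap A (FractionRing A) d ≠ 0 := by
    simpa using hd
  have hdL : algebraMap A L d ≠ 0 := by
    rwa [Ne, map_eq_zero_iff _ hinj]
  have hg : g (algebraMap A (FractionRing A) s / algebraMap A (FractionRing A) d) = f := by
    rw [map_div₀, AlgHom.commutes, AlgHom.commutes, ← h, mul_div_cancel_left₀ _ hdL]
  rw [← hg, isIntegral_algHom_iff g g.injective, IsIntegrallyClosed.isIntegral_iff] at hf
  obtain ⟨c, hc⟩ := hf
  refine ⟨c, IsFractionRing.injective A (FractionRing A) ?_⟩
  rw [map_mul, hc, mul_div_cancel₀ _ hd']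

/-- The involution of the function field. -/
def conjF (W : WeierstrassCurve K) :
    W.toAffine.FunctionField →ₐ[K[X]] W.toAffine.FunctionField :=
  IsFractionRing.liftAlgHom (g := ((IsScalarTower.toAlgHom K[X] W.toAffine.CoordinateRing
    W.toAffine.FunctionField).comp (conj W)))
    ((IsFractionRing.injective W.toAffine.CoordinateRing W.toAffine.FunctionField).comp
      (conjEquiv W).injective)

theorem conjF_algebraMap (r : W.toAffine.CoordinateRing) :
    conjF W (algebraMap _ _ r) = algebraMap _ _ (conj W r) := by
  simp [conjF, IsFractionRing.liftAlgHom]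

theorem algebraMap_polynomial_injective :
    Function.Injective (algebraMap K[X] W.toAffine.FunctionField) := by
  rw [IsScalarTower.algebraMap_eq K[X] W.toAffine.CoordinateRing W.toAffine.FunctionField]
  exact (IsFractionRing.injective W.toAffine.CoordinateRing W.toAffine.FunctionField).comp
    xPoly_injective

/-- The trace and norm of `f = (p + q y) / π` are integral over `K[X]` and rational, hence
polynomials. So `π` divides the trace and `π ^ 2` the norm of the numerator, and nonsingularity then
makes `π` divide `p` and `q`. -/
theorem exists_algebraMap_eq_of_prime_mul [W.IsElliptic] {π : K[X]} (hπ : Prime π)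
    {f : W.toAffine.FunctionField} (hf : IsIntegral K[X] f) {r : W.toAffine.CoordinateRing}
    (h : algebraMap K[X] _ π * f = algebraMap _ _ r) :
    ∃ s, algebraMap W.toAffine.CoordinateRing W.toAffine.FunctionField s = f := by
  have hf' : IsIntegral K[X] (conjF W f) := hf.map (conjF W)
  have h' : algebraMap K[X] _ π * conjF W f =
      algebraMap _ W.toAffine.FunctionField (conj W r) := by
    rw [← conjF_algebraMap, ← h, map_mul, AlgHom.commutes]
  obtain ⟨p, q, rfl⟩ := exists_eq_add_mul_yClass r
  have hx : ∀ s : K[X], algebraMap W.toAffine.CoordinateRing W.toAffine.FunctionField (xPoly W s) =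
      algebraMap K[X] _ s := fun s => (IsScalarTower.algebraMap_apply ..).symm
  have htr : π ∣ 2 * p - q * linPoly W := by
    refine dvd_of_isIntegral_of_mul_eq (algebraMap_polynomial_injective (W := W)) hπ.ne_zero
      (hf.add hf') ?_
    rw [mul_add, h, h', ← map_add, ← hx]
    congr 1
    simp only [map_add, map_mul, conj_xPoly, conj_yClass, map_sub, map_ofNat]
    ring
  have hnm : π ^ 2 ∣ p ^ 2 - p * q * linPoly W - q ^ 2 * cubicPoly W := by
    refine dvd_of_isIntegral_of_mul_eq (algebraMap_polynomial_injective (W := W))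
      (pow_ne_zero 2 hπ.ne_zero) (hf.mul hf') ?_
    rw [map_pow, sq, mul_mul_mul_comm, h, h', ← map_mul, mul_conj, norm_add_mul_yClass, hx]
  obtain ⟨⟨p', rfl⟩, q', rfl⟩ := dvd_of_dvd_trace_of_sq_dvd_norm hπ htr hnm
  refine ⟨xPoly W p' + xPoly W q' * yClass W, ?_⟩
  have hπ0 : algebraMap K[X] W.toAffine.FunctionField π ≠ 0 := by
    rw [Ne, map_eq_zero_iff _ algebraMap_polynomial_injective]
    exact hπ.ne_zero
  apply mul_left_cancel₀ hπ0
  rw [h, ← hx, ← map_mul]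
  congr 1
  simp only [map_mul]
  ring

theorem exists_algebraMap_eq_of_mul [W.IsElliptic] (d : K[X]) (hd : d ≠ 0)
    {f : W.toAffine.FunctionField} (hf : IsIntegral K[X] f) {r : W.toAffine.CoordinateRing}
    (h : algebraMap K[X] _ d * f = algebraMap _ _ r) :
    ∃ s, algebraMap W.toAffine.CoordinateRing W.toAffine.FunctionField s = f := by
  induction d using UniqueFactorizationMonoid.induction_on_prime generalizing f r with
  | h₁ => exact absurd rfl hd
  | h₂ d hu =>
    obtain ⟨e, he⟩ := hu.exists_left_inv
    refine ⟨xPoly W e * r, ?_⟩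
    rw [map_mul, ← h, ← mul_assoc, ← IsScalarTower.algebraMap_apply, ← map_mul, he, map_one, one_mul]
  | h₃ d π hd0 hπ ih =>
    rw [map_mul, mul_assoc] at h
    obtain ⟨s, hs⟩ := exists_algebraMap_eq_of_prime_mul hπ (isIntegral_algebraMap.mul hf) h
    exact ih hd0 hf hs.symm

/-- A fraction `a / b` equals `a * conj b` over the polynomial norm of `b`. The prime factors of
that denominator can then be removed one at a time. -/
instance [W.IsElliptic] : IsIntegrallyClosed W.toAffine.CoordinateRing := by
  refine (isIntegrallyClosed_iff W.toAffine.FunctionField).mpr fun {f} hf => ?_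
  have hf' : IsIntegral K[X] f := isIntegral_trans f hf
  obtain ⟨a, b, hb, rfl⟩ := IsFractionRing.div_surjective (A := W.toAffine.CoordinateRing) f
  have hb0 : b ≠ 0 := nonZeroDivisors.ne_zero hb
  refine exists_algebraMap_eq_of_mul (Algebra.norm K[X] b) (norm_ne_zero hb0) hf'
    (r := a * conj W b) ?_
  have hb1 : algebraMap W.toAffine.CoordinateRing W.toAffine.FunctionField b ≠ 0 := by
    simpa using hb0
  rw [IsScalarTower.algebraMap_apply K[X] W.toAffine.CoordinateRing W.toAffine.FunctionField,
    show algebraMap K[X] W.toAffine.CoordinateRing (Algebra.norm K[X] b) = b * conj W b from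
      (mul_conj b).symm, map_mul, map_mul]
  field_simp

instance [W.IsElliptic] : IsDedekindDomain W.toAffine.CoordinateRing :=
  haveI : Ring.DimensionLEOne W.toAffine.CoordinateRing := ⟨by
    intro p hp0 hp
    have := hp
    have : Algebra.IsIntegral K[X] W.toAffine.CoordinateRing := inferInstance
    refine Ideal.isMaximal_of_isIntegral_of_isMaximal_comap (R := K[X]) p ?_
    obtain ⟨x, hx, hx0⟩ := p.ne_bot_iff.mp hp0
    have : (Ideal.comap (algebraMap K[X] W.toAffine.CoordinateRing) p).IsPrime :=
      Ideal.comap_isPrime _ _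
    exact Ideal.IsPrime.isMaximal inferInstance
      (Ideal.comap_ne_bot_of_integral_mem hx0 hx (Algebra.IsIntegral.isIntegral x))⟩
  haveI : IsNoetherianRing W.toAffine.CoordinateRing := inferInstance
  haveI : IsDedekindRing W.toAffine.CoordinateRing := {}
  {}

end CoordinateRing

/-! ### The valuation at infinity. -/

section InfinityValuation

variable {K : Type*} [Field K] {W : WeierstrassCurve K}

theorem norm_zero : Algebra.norm K[X] (0 : W.toAffine.CoordinateRing) = 0 := by
  simp

theorem nsmul_degree_add_lt_iff (p : K[X]) (a N : ℕ) :
    2 • p.degree + (a : WithBot ℕ) < (N : WithBot ℕ) ↔ ∀ i, N ≤ 2 * i + a → p.coeff i = 0 := by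
  rcases eq_or_ne p 0 with rfl | hp
  · simp
  · rw [degree_eq_natDegree hp]
    have : 2 • (p.natDegree : WithBot ℕ) + (a : WithBot ℕ) =
        ((2 * p.natDegree + a : ℕ) : WithBot ℕ) := by
      push_cast
      rw [nsmul_eq_mul]
      norm_cast
    rw [this, Nat.cast_lt]
    constructor
    · intro h i hi
      exact coeff_eq_zero_of_natDegree_lt (by omega)
    · intro h
      by_contra! h'
      exact hp (leadingCoeff_eq_zero.mp (h _ h'))

/-- The contributions `2 deg p` and `2 deg q + 3` have different parity and never cancel, so the
bound is a set of linear conditions on coefficients. This yields the ultrametric inequality. -/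
theorem degree_norm_lt_iff (p q : K[X]) (N : ℕ) :
    (Algebra.norm K[X] (xPoly W p + xPoly W q * yClass W)).degree < (N : WithBot ℕ) ↔
      (∀ i, N ≤ 2 * i → p.coeff i = 0) ∧ ∀ i, N ≤ 2 * i + 3 → q.coeff i = 0 := by
  rw [degree_norm_add_mul_yClass, max_lt_iff, ← nsmul_degree_add_lt_iff q 3 N]
  have := nsmul_degree_add_lt_iff p 0 N
  simp only [Nat.cast_zero, add_zero] at this
  rw [this]
  rfl

/-- The degree of the norm of an element of the coordinate ring: its pole order at infinity. -/
def normDeg (r : W.toAffine.CoordinateRing) : ℕ := (Algebra.norm K[X] r).natDegree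

theorem normDeg_mul {r s : W.toAffine.CoordinateRing} (hr : r ≠ 0) (hs : s ≠ 0) :
    normDeg (r * s) = normDeg r + normDeg s := by
  rw [normDeg, map_mul, natDegree_mul (norm_ne_zero hr) (norm_ne_zero hs)]
  rfl

theorem normDeg_lt_iff {r : W.toAffine.CoordinateRing} (hr : r ≠ 0) {N : ℕ} :
    normDeg r < N ↔ (Algebra.norm K[X] r).degree < (N : WithBot ℕ) := by
  rw [degree_eq_natDegree (norm_ne_zero hr), Nat.cast_lt]
  rfl

theorem degree_norm_add_lt {r s : W.toAffine.CoordinateRing} {N : ℕ}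
    (hr : (Algebra.norm K[X] r).degree < (N : WithBot ℕ))
    (hs : (Algebra.norm K[X] s).degree < (N : WithBot ℕ)) :
    (Algebra.norm K[X] (r + s)).degree < (N : WithBot ℕ) := by
  obtain ⟨p, q, rfl⟩ := exists_eq_add_mul_yClass r
  obtain ⟨p', q', rfl⟩ := exists_eq_add_mul_yClass s
  have : xPoly W p + xPoly W q * yClass W + (xPoly W p' + xPoly W q' * yClass W) =
      xPoly W (p + p') + xPoly W (q + q') * yClass W := by
    simp only [map_add]
    ring
  rw [this]
  rw [degree_norm_lt_iff] at hr hs ⊢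
  exact ⟨fun i hi => by rw [coeff_add, hr.1 i hi, hs.1 i hi, add_zero],
    fun i hi => by rw [coeff_add, hr.2 i hi, hs.2 i hi, add_zero]⟩

open Classical in
/-- The valuation at infinity on the coordinate ring. -/
def infValRing (W : WeierstrassCurve K) : Valuation W.toAffine.CoordinateRing ℤᵐ⁰ where
  toFun r := if r = 0 then 0 else WithZero.exp (normDeg r : ℤ)
  map_zero' := by simp
  map_one' := by simp [normDeg]
  map_mul' r s := by
    rcases eq_or_ne r 0 with rfl | hr
    · simp
    rcases eq_or_ne s 0 with rfl | hs
    · simp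
    rw [if_neg hr, if_neg hs, if_neg (mul_ne_zero hr hs), normDeg_mul hr hs, Nat.cast_add,
      WithZero.exp_add]
  map_add_le_max' r s := by
    rcases eq_or_ne r 0 with rfl | hr
    · simp
    rcases eq_or_ne s 0 with rfl | hs
    · simp
    rcases eq_or_ne (r + s) 0 with hrs | hrs
    · simp [hrs]
    rw [if_neg hr, if_neg hs, if_neg hrs, le_max_iff, WithZero.exp_le_exp, WithZero.exp_le_exp,
      Nat.cast_le, Nat.cast_le, ← le_max_iff, ← Nat.lt_succ_iff, normDeg_lt_iff hrs]
    apply degree_norm_add_lt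
    · rw [← normDeg_lt_iff hr, Nat.lt_succ_iff]
      exact le_max_left _ _
    · rw [← normDeg_lt_iff hs, Nat.lt_succ_iff]
      exact le_max_right _ _

theorem infValRing_apply {r : W.toAffine.CoordinateRing} (hr : r ≠ 0) :
    infValRing W r = WithZero.exp (normDeg r : ℤ) :=
  if_neg hr

/-- The valuation at infinity on the function field. -/
def infVal (W : WeierstrassCurve K) : Valuation W.toAffine.FunctionField ℤᵐ⁰ :=
  (infValRing W).extendToLocalization (S := nonZeroDivisors W.toAffine.CoordinateRing)
    (fun r hr => by
      rw [Ideal.mem_primeCompl_iff, Valuation.mem_supp_iff,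
        infValRing_apply (nonZeroDivisors.ne_zero hr)]
      exact WithZero.exp_ne_zero) W.toAffine.FunctionField

theorem infVal_algebraMap {r : W.toAffine.CoordinateRing} (hr : r ≠ 0) :
    infVal W (algebraMap _ _ r) = WithZero.exp (normDeg r : ℤ) := by
  rw [infVal, Valuation.extendToLocalization_apply_map_apply, infValRing_apply hr]

theorem infVal_lt_exp_iff (p q : K[X]) (N : ℕ) :
    infVal W (algebraMap _ _ (xPoly W p + xPoly W q * yClass W)) < WithZero.exp (N : ℤ) ↔
      (∀ i, N ≤ 2 * i → p.coeff i = 0) ∧ ∀ i, N ≤ 2 * i + 3 → q.coeff i = 0 := by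
  rw [← degree_norm_lt_iff (W := W)]
  rcases eq_or_ne (xPoly W p + xPoly W q * yClass W) 0 with h | h
  · rw [h, map_zero, map_zero, norm_zero, degree_zero]
    simp
  · rw [infVal_algebraMap h, WithZero.exp_lt_exp, Nat.cast_lt, normDeg_lt_iff h]

theorem normDeg_xPoly (p : K[X]) : normDeg (xPoly W p) = 2 * p.natDegree := by
  have h := norm_add_mul_yClass (W := W) p 0
  rw [show xPoly W 0 = 0 from map_zero _, zero_mul, add_zero] at h
  rw [normDeg, h]
  simp

theorem normDeg_yClass : normDeg (yClass W) = 3 := by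
  have h := degree_norm_add_mul_yClass (W := W) 0 1
  rw [show xPoly W 0 = 0 from map_zero _, show xPoly W 1 = 1 from map_one _, one_mul,
    zero_add] at h
  rw [normDeg, natDegree_eq_of_degree_eq_some (n := 3)]
  rw [h]
  simp

theorem yClass_ne_zero : yClass W ≠ 0 := by
  intro h
  have := normDeg_yClass (W := W)
  rw [h, normDeg, norm_zero] at this
  simp at this

theorem xFun_eq : xFun W = algebraMap W.toAffine.CoordinateRing _ (xPoly W X) := rfl

theorem yFun_eq : yFun W = algebraMap W.toAffine.CoordinateRing _ (yClass W) := rfl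

theorem algebraMap_const (c : K) : algebraMap K W.toAffine.FunctionField c =
    algebraMap W.toAffine.CoordinateRing _ (xPoly W (C c)) := by
  rw [IsScalarTower.algebraMap_apply K W.toAffine.CoordinateRing W.toAffine.FunctionField]
  rfl

theorem infVal_xFun : infVal W (xFun W) = WithZero.exp 2 := by
  rw [xFun_eq, infVal_algebraMap, normDeg_xPoly]
  · simp
  · rw [Ne, map_eq_zero_iff _ xPoly_injective]
    exact X_ne_zero

theorem infVal_yFun : infVal W (yFun W) = WithZero.exp 3 := by
  rw [yFun_eq, infVal_algebraMap yClass_ne_zero, normDeg_yClass]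
  simp

theorem infVal_const {c : K} (hc : c ≠ 0) :
    infVal W (algebraMap K W.toAffine.FunctionField c) = 1 := by
  rw [algebraMap_const, infVal_algebraMap, normDeg_xPoly]
  · simp
  · rw [Ne, map_eq_zero_iff _ xPoly_injective]
    exact C_ne_zero.mpr hc

/-- The residue field at infinity is `K`. The monomials `X ^ i` and `X ^ i Y` have pairwise distinct
pole orders, so the constant is the quotient of the coefficients of `a` and `b` at the leading
monomial of `b`. -/
theorem infVal_exists_const_sub_lt_one {f : W.toAffine.FunctionField} (hf : infVal W f ≤ 1) :
    ∃ c : K, infVal W (f - algebraMap K _ c) < 1 := by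
  obtain ⟨a, b, hb, rfl⟩ := IsFractionRing.div_surjective (A := W.toAffine.CoordinateRing) f
  have hb0 : b ≠ 0 := nonZeroDivisors.ne_zero hb
  have hb1 : algebraMap W.toAffine.CoordinateRing W.toAffine.FunctionField b ≠ 0 := by
    simpa using hb0
  have hbv : 0 < infVal W (algebraMap _ _ b) := by
    rw [Valuation.pos_iff]
    exact hb1
  rw [map_div₀, div_le_one₀ hbv] at hf
  suffices h : ∃ c : K, infVal W (algebraMap _ _ (a - xPoly W (C c) * b)) <
      infVal W (algebraMap _ _ b) by
    obtain ⟨c, hc⟩ := h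
    refine ⟨c, ?_⟩
    rw [algebraMap_const, div_sub' hb1, map_div₀, div_lt_one₀ hbv]
    rwa [mul_comm, ← map_mul, ← map_sub]
  obtain ⟨p, q, rfl⟩ := exists_eq_add_mul_yClass a
  obtain ⟨p', q', rfl⟩ := exists_eq_add_mul_yClass b
  have hsub : ∀ c, xPoly W p + xPoly W q * yClass W -
      xPoly W (C c) * (xPoly W p' + xPoly W q' * yClass W) =
      xPoly W (p - C c * p') + xPoly W (q - C c * q') * yClass W := by
    intro c
    simp only [map_sub, map_mul]
    ring
  simp only [hsub]
  set b := xPoly W p' + xPoly W q' * yClass W with hbdef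
  have hN := infVal_algebraMap hb0
  have ha' : infVal W (algebraMap _ _ (xPoly W p + xPoly W q * yClass W)) <
      WithZero.exp ((normDeg b + 1 : ℕ) : ℤ) := by
    refine hf.trans_lt ?_
    rw [hN, WithZero.exp_lt_exp]
    push_cast
    omega
  have hb' : infVal W (algebraMap _ _ b) < WithZero.exp ((normDeg b + 1 : ℕ) : ℤ) := by
    rw [hN, WithZero.exp_lt_exp]
    push_cast
    omega
  have hb'' : ¬ infVal W (algebraMap _ _ b) < WithZero.exp (normDeg b : ℤ) := by
    rw [hN]
    exact lt_irrefl _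
  simp only [hN, infVal_lt_exp_iff]
  rw [infVal_lt_exp_iff] at ha'
  rw [hbdef, infVal_lt_exp_iff, ← hbdef] at hb' hb''
  -- The leading monomial of `b` is `X ^ i` or `X ^ i Y`. If neither coefficient were non-zero, the
  -- pole order of `b` would be smaller than `normDeg b`.
  by_cases h : ∃ i, normDeg b = 2 * i ∧ p'.coeff i ≠ 0
  · obtain ⟨i, hi, hpi⟩ := h
    refine ⟨p.coeff i / p'.coeff i, fun j hj => ?_, fun j hj => ?_⟩
    · rcases eq_or_ne j i with rfl | hji
      · rw [coeff_sub, coeff_C_mul, div_mul_cancel₀ _ hpi, sub_self]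
      · rw [coeff_sub, coeff_C_mul, ha'.1 j (by omega), hb'.1 j (by omega), mul_zero, sub_zero]
    · rw [coeff_sub, coeff_C_mul, ha'.2 j (by omega), hb'.2 j (by omega), mul_zero, sub_zero]
  · by_cases h' : ∃ i, normDeg b = 2 * i + 3 ∧ q'.coeff i ≠ 0
    · obtain ⟨i, hi, hpi⟩ := h'
      refine ⟨q.coeff i / q'.coeff i, fun j hj => ?_, fun j hj => ?_⟩
      · rw [coeff_sub, coeff_C_mul, ha'.1 j (by omega), hb'.1 j (by omega), mul_zero, sub_zero]
      · rcases eq_or_ne j i with rfl | hji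
        · rw [coeff_sub, coeff_C_mul, div_mul_cancel₀ _ hpi, sub_self]
        · rw [coeff_sub, coeff_C_mul, ha'.2 j (by omega), hb'.2 j (by omega), mul_zero, sub_zero]
    · push Not at h h'
      refine absurd ⟨fun j hj => ?_, fun j hj => ?_⟩ hb''
      · rcases hj.eq_or_lt with hj | hj
        · exact h j hj
        · exact hb'.1 j hj
      · rcases hj.eq_or_lt with hj | hj
        · exact h' j hj
        · exact hb'.2 j hj

end InfinityValuation

/-! ### Discrete valuations of a field and closed points. -/

section DiscreteValuations

/-- A discrete valuation ring of a field is a maximal proper subring, on the level of normalised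
valuations. -/
theorem valuation_eq_of_le_one {F : Type*} [Field F] {v w : Valuation F ℤᵐ⁰}
    (hv : ∃ t, v t = WithZero.exp (-1)) (hw : ∃ t, w t = WithZero.exp (-1))
    (h : ∀ f, v f ≤ 1 → w f ≤ 1) : v = w := by
  obtain ⟨t, ht⟩ := hv
  have ht0 : t ≠ 0 := by
    rintro rfl
    rw [map_zero] at ht
    exact WithZero.exp_ne_zero ht.symm
  have hunit : ∀ u, v u = 1 → w u = 1 := by
    intro u hu
    refine le_antisymm (h u hu.le) ?_
    have h1 : w u⁻¹ ≤ 1 := h _ (by rw [map_inv₀, hu, inv_one])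
    have hu0 : 0 < w u := by
      rw [Valuation.pos_iff]
      rintro rfl
      simp at hu
    rwa [map_inv₀, inv_le_one₀ hu0] at h1
  -- Every `f` is a `v`-unit times a power of the uniformizer `t`, and `v`-units are `w`-units. So
  -- `w` is determined by `w t`.
  have hdec : ∀ f, f ≠ 0 → ∃ n : ℤ, v f = WithZero.exp n ∧ w f = w t ^ (-n) := by
    intro f hf
    have hvf : v f ≠ 0 := (Valuation.ne_zero_iff v).mpr hf
    refine ⟨WithZero.log (v f), (WithZero.exp_log hvf).symm, ?_⟩
    have := hunit (f * t ^ (WithZero.log (v f))) (by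
      rw [map_mul, map_zpow₀, ht, ← WithZero.exp_zsmul, smul_eq_mul, mul_neg, mul_one,
        WithZero.exp_neg, WithZero.exp_log hvf, mul_inv_cancel₀ hvf])
    rw [map_mul, map_zpow₀] at this
    rw [zpow_neg]
    exact eq_inv_of_mul_eq_one_left this
  have hwt0 : w t ≠ 0 := (Valuation.ne_zero_iff w).mpr ht0
  have hwt1 : w t ≤ 1 := h t (by rw [ht, ← WithZero.exp_zero, WithZero.exp_le_exp]; omega)
  have hwt : w t = WithZero.exp (-1) := by
    -- Because `w` takes the value `exp (-1)`, the integer `log (w t)` is a unit. The bound `w t ≤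
    -- 1` fixes its sign.
    obtain ⟨s, hs⟩ := hw
    obtain ⟨n, -, hn⟩ := hdec s (by
      rintro rfl
      rw [map_zero] at hs
      exact WithZero.exp_ne_zero hs.symm)
    rw [hs] at hn
    rw [← WithZero.exp_log hwt0] at hn hwt1 ⊢
    rw [← WithZero.exp_zsmul, WithZero.exp_inj, smul_eq_mul] at hn
    rw [← WithZero.exp_zero, WithZero.exp_le_exp] at hwt1
    rw [WithZero.exp_inj]
    rcases Int.isUnit_iff.mp (IsUnit.of_mul_eq_one n (by linarith : WithZero.log (w t) * n = 1))
      with h | h <;> omega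
  ext f
  rcases eq_or_ne f 0 with rfl | hf
  · simp
  obtain ⟨n, hn, hn'⟩ := hdec f hf
  rw [hn, hn', hwt, ← WithZero.exp_zsmul]
  simp

variable {K F : Type*} [Field K] [Field F] [Algebra K F]

theorem ClosedPoint.valuation_le_one_iff (v : ClosedPoint K F) {f : F} :
    v.valuation f ≤ 1 ↔ f ∈ v.ring := by
  have := v.isDVR
  constructor
  · intro h
    obtain ⟨a, rfl⟩ := IsDiscreteValuationRing.exists_lift_of_le_one (A := v.ring) h
    exact a.2
  · intro h
    exact (IsDiscreteValuationRing.maximalIdeal v.ring).valuation_le_one (K := F) (⟨f, h⟩ : v.ring)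

theorem ClosedPoint.exists_uniformizer (v : ClosedPoint K F) :
    ∃ t, v.valuation t = WithZero.exp (-1) :=
  haveI := v.isDVR
  (IsDiscreteValuationRing.maximalIdeal v.ring).valuation_exists_uniformizer F

theorem ClosedPoint.valuation_const (v : ClosedPoint K F) {c : K} (hc : c ≠ 0) :
    v.valuation (algebraMap K F c) = 1 := by
  refine le_antisymm (v.valuation_algebraMap_le_one c) ?_
  have h := v.valuation_algebraMap_le_one c⁻¹
  have h0 : 0 < v.valuation (algebraMap K F c) := by
    rw [Valuation.pos_iff]
    simpa using hc
  rwa [map_inv₀, map_inv₀, inv_le_one₀ h0] at h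

/-- Every normalised discrete valuation that is trivial on the constants comes from a closed
point. -/
theorem exists_closedPoint_valuation_eq (w : Valuation F ℤᵐ⁰) (hw : ∃ t, w t = WithZero.exp (-1))
    (hK : ∀ c : K, w (algebraMap K F c) ≤ 1) : ∃ v : ClosedPoint K F, v.valuation = w := by
  have hdvr : IsDiscreteValuationRing w.valuationSubring := by
    obtain ⟨t, ht⟩ := hw
    have : Nontrivial (MonoidWithZeroHom.valueGroup (.ofClass w)) := by
      rw [Subgroup.nontrivial_iff_exists_ne_one]
      refine ⟨Units.mk0 (w t) (by rw [ht]; exact WithZero.exp_ne_zero), ?_, ?_⟩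
      · apply MonoidWithZeroHom.mem_valueGroup
        exact ⟨t, rfl⟩
      · intro h
        have := congrArg Units.val h
        rw [Units.val_mk0, ht, Units.val_one, ← WithZero.exp_zero, WithZero.exp_inj] at this
        omega
    infer_instance
  let v : ClosedPoint K F := ⟨w.valuationSubring, hK, hdvr⟩
  refine ⟨v, valuation_eq_of_le_one v.exists_uniformizer hw fun f hf => ?_⟩
  exact v.valuation_le_one_iff.mp hf

end DiscreteValuations

/-! ### Closed points at affine rational points. -/

section RationalPoints

variable {K : Type*} [Field K] {W : WeierstrassCurve K}

theorem exists_const_sub_mem_XYIdeal {a b : K} (h : W.toAffine.Equation a b)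
    (r : W.toAffine.CoordinateRing) :
    ∃ c : K, r - algebraMap K _ c ∈ Affine.CoordinateRing.XYIdeal W.toAffine a (C b) := by
  have h' : (W.toAffine.polynomial.eval (C b)).eval a = 0 := h
  let e := Affine.CoordinateRing.quotientXYIdealEquiv h'
  refine ⟨e (Ideal.Quotient.mk _ r), ?_⟩
  rw [← Ideal.Quotient.eq]
  apply e.injective
  exact (e.commutes _).symm

/-- The maximal ideal of the coordinate ring at an affine rational point. -/
def pointSpectrum {a b : K} (h : W.toAffine.Nonsingular a b) :
    HeightOneSpectrum W.toAffine.CoordinateRing where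
  asIdeal := Affine.CoordinateRing.XYIdeal W.toAffine a (C b)
  isPrime := by
    have h' : (W.toAffine.polynomial.eval (C b)).eval a = 0 := h.1
    have := (Ideal.Quotient.maximal_of_isField _
      ((Affine.CoordinateRing.quotientXYIdealEquiv h').toMulEquiv.isField (Field.toIsField K)))
    exact this.isPrime
  ne_bot := by
    intro h0
    have : Affine.CoordinateRing.XClass W.toAffine a ∈
        Affine.CoordinateRing.XYIdeal W.toAffine a (C b) := Ideal.subset_span (by simp)
    rw [h0, Ideal.mem_bot] at this
    exact Affine.CoordinateRing.XClass_ne_zero a this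

/-- The normalised valuation at a rational point. -/
def ptVal [W.IsElliptic] : W.toAffine.Point → Valuation W.toAffine.FunctionField ℤᵐ⁰
  | .zero => infVal W
  | .some _ _ h => (pointSpectrum h).valuation W.toAffine.FunctionField

theorem algebraMap_XClass (a : K) :
    algebraMap W.toAffine.CoordinateRing W.toAffine.FunctionField
      (Affine.CoordinateRing.XClass W.toAffine a) = xFun W - algebraMap K _ a := by
  rw [algebraMap_const, xFun_eq, ← map_sub, ← map_sub]
  rfl

theorem algebraMap_YClass (b : K) :
    algebraMap W.toAffine.CoordinateRing W.toAffine.FunctionField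
      (Affine.CoordinateRing.YClass W.toAffine (C b)) = yFun W - algebraMap K _ b := by
  rw [algebraMap_const, yFun_eq, ← map_sub]
  rw [Affine.CoordinateRing.YClass, map_sub]
  rfl

theorem algebraMap_xPoly (p : K[X]) :
    algebraMap W.toAffine.CoordinateRing W.toAffine.FunctionField (xPoly W p) =
      aeval (xFun W) p := by
  induction p using Polynomial.induction_on' with
  | add p q hp hq => rw [show xPoly W (p + q) = xPoly W p + xPoly W q from map_add _ _ _, map_add, map_add, hp, hq]
  | monomial n c =>
    rw [← C_mul_X_pow_eq_monomial,
      show xPoly W (C c * X ^ n) = xPoly W (C c) * xPoly W X ^ n by rw [xPoly, map_mul, map_pow],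
      map_mul, map_pow, ← algebraMap_const,
      ← xFun_eq, map_mul, aeval_C, map_pow, aeval_X]

theorem yFun_sq : yFun W ^ 2 = aeval (xFun W) (cubicPoly W) -
    aeval (xFun W) (linPoly W) * yFun W := by
  rw [yFun_eq, ← map_pow, yClass_sq, map_sub, map_mul, algebraMap_xPoly, algebraMap_xPoly]

/-- The Weierstrass equation in the function field. -/
theorem equation_xFun_yFun :
    yFun W ^ 2 + algebraMap K _ W.a₁ * xFun W * yFun W + algebraMap K _ W.a₃ * yFun W =
      xFun W ^ 3 + algebraMap K _ W.a₂ * xFun W ^ 2 + algebraMap K _ W.a₄ * xFun W +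
        algebraMap K _ W.a₆ := by
  rw [yFun_sq, cubicPoly, linPoly]
  simp only [map_add, map_mul, map_pow, aeval_C, aeval_X]
  ring

variable (v : ClosedPoint K W.toAffine.FunctionField)

theorem valuation_aeval_xFun_le_one (hx : v.valuation (xFun W) ≤ 1) (p : K[X]) :
    v.valuation (aeval (xFun W) p) ≤ 1 := by
  induction p using Polynomial.induction_on' with
  | add p q hp hq =>
    rw [map_add]
    exact (Valuation.map_add _ _ _).trans (max_le hp hq)
  | monomial n c =>
    rw [aeval_monomial, map_mul, map_pow]
    exact mul_le_one' (v.valuation_algebraMap_le_one c) (pow_le_one' hx n)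

/-- The function `y` is integral over `K[x]`: if `v(y) > 1`, the Weierstrass equation would give
`v(y) ^ 2 ≤ v(y)`. -/
theorem valuation_yFun_le_one (hx : v.valuation (xFun W) ≤ 1) : v.valuation (yFun W) ≤ 1 := by
  by_contra! hy
  have h1 : v.valuation (yFun W ^ 2) ≤ v.valuation (yFun W) := by
    rw [yFun_sq]
    refine (Valuation.map_sub _ _ _).trans (max_le ?_ ?_)
    · exact (valuation_aeval_xFun_le_one v hx _).trans hy.le
    · rw [map_mul]
      exact mul_le_of_le_one_left' (valuation_aeval_xFun_le_one v hx _)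
  rw [map_pow, sq] at h1
  have h0 : 0 < v.valuation (yFun W) := zero_lt_one.trans hy
  have := (mul_le_iff_le_one_left h0).mp h1
  exact absurd this hy.not_ge

theorem valuation_algebraMap_le_one (hx : v.valuation (xFun W) ≤ 1)
    (r : W.toAffine.CoordinateRing) : v.valuation (algebraMap _ _ r) ≤ 1 := by
  obtain ⟨p, q, rfl⟩ := exists_eq_add_mul_yClass r
  rw [map_add, map_mul, algebraMap_xPoly, algebraMap_xPoly, ← yFun_eq]
  refine (Valuation.map_add _ _ _).trans (max_le (valuation_aeval_xFun_le_one v hx _) ?_)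
  rw [map_mul]
  exact mul_le_one' (valuation_aeval_xFun_le_one v hx _) (valuation_yFun_le_one v hx)

theorem valuation_xFun_le_one_of_sub {a : K}
    (h : v.valuation (xFun W - algebraMap K _ a) ≤ 1) : v.valuation (xFun W) ≤ 1 := by
  have : xFun W = (xFun W - algebraMap K _ a) + algebraMap K _ a := by ring
  rw [this]
  exact (Valuation.map_add _ _ _).trans (max_le h (v.valuation_algebraMap_le_one a))

/-- It suffices to contain one valuation ring in the other. An element of the local ring at the
point is `n / d` with `d` outside the maximal ideal; such a `d` is a non-zero constant modulo that
ideal, hence a unit at `v`. -/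
theorem eq_ptVal_of_isAt_some [W.IsElliptic] {a b : K} (h : W.toAffine.Nonsingular a b)
    (hx : v.valuation (xFun W - algebraMap K _ a) < 1)
    (hy : v.valuation (yFun W - algebraMap K _ b) < 1) :
    (pointSpectrum h).valuation W.toAffine.FunctionField = v.valuation := by
  refine valuation_eq_of_le_one ((pointSpectrum h).valuation_exists_uniformizer _)
    v.exists_uniformizer fun f hf => ?_
  have hx1 := valuation_xFun_le_one_of_sub v hx.le
  have hm : ∀ r ∈ Affine.CoordinateRing.XYIdeal W.toAffine a (C b),
      v.valuation (algebraMap _ _ r) < 1 := by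
    intro r hr
    rw [Affine.CoordinateRing.XYIdeal, Ideal.mem_span_pair] at hr
    obtain ⟨α, β, rfl⟩ := hr
    rw [map_add, map_mul, map_mul, algebraMap_XClass, algebraMap_YClass]
    refine Valuation.map_add_lt _ ?_ ?_
    · rw [map_mul]
      exact (mul_le_of_le_one_left' (valuation_algebraMap_le_one v hx1 α)).trans_lt hx
    · rw [map_mul]
      exact (mul_le_of_le_one_left' (valuation_algebraMap_le_one v hx1 β)).trans_lt hy
  obtain ⟨n, ⟨d, hd⟩, hnd⟩ := (pointSpectrum h).exists_primeCompl_mul_eq_of_integer f hf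
  have hvd : v.valuation (algebraMap _ _ d) = 1 := by
    obtain ⟨c, hc⟩ := exists_const_sub_mem_XYIdeal h.1 d
    have hc0 : c ≠ 0 := by
      rintro rfl
      rw [map_zero, sub_zero] at hc
      exact hd hc
    have := hm _ hc
    rw [map_sub, ← IsScalarTower.algebraMap_apply, ← v.valuation_const hc0] at this
    rw [← v.valuation_const hc0]
    exact Valuation.map_eq_of_sub_lt _ this
  have := congrArg v.valuation hnd
  rw [map_mul, hvd, mul_one] at this
  rw [this]
  exact valuation_algebraMap_le_one v hx1 n

end RationalPoints

/-! ### Uniqueness of the closed point at infinity. -/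

section PointsAtInfinity

variable {K : Type*} [Field K] {W : WeierstrassCurve K} (v : ClosedPoint K W.toAffine.FunctionField)

theorem xFun_ne_zero : xFun W ≠ 0 := by
  intro h
  have := infVal_xFun (W := W)
  rw [h, map_zero] at this
  exact WithZero.exp_ne_zero this.symm

theorem valuation_const_mul_le (c : K) (f : W.toAffine.FunctionField) :
    v.valuation (algebraMap K _ c * f) ≤ v.valuation f := by
  rw [map_mul]
  exact mul_le_of_le_one_left' (v.valuation_algebraMap_le_one c)

/-- At a pole of `x` the values of `x` and `y` are the square and the cube of that of `y / x`. -/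
theorem valuation_xFun_yFun_of_one_lt (hx : 1 < v.valuation (xFun W)) :
    ∃ ρ : ℤᵐ⁰, 1 < ρ ∧ v.valuation (xFun W) = ρ ^ 2 ∧ v.valuation (yFun W) = ρ ^ 3 := by
  set ξ := v.valuation (xFun W) with hξ
  set η := v.valuation (yFun W) with hη
  have hξ0 : 0 < ξ := zero_lt_one.trans hx
  have hcub : v.valuation (aeval (xFun W) (cubicPoly W)) = ξ ^ 3 := by
    have : aeval (xFun W) (cubicPoly W) = xFun W ^ 3 + (algebraMap K _ W.a₂ * xFun W ^ 2 +
        algebraMap K _ W.a₄ * xFun W ^ 1 + algebraMap K _ W.a₆ * xFun W ^ 0) := by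
      simp only [cubicPoly, map_add, map_mul, map_pow, aeval_C, aeval_X]
      ring
    rw [this, Valuation.map_add_eq_of_lt_left, map_pow]
    have hterm : ∀ c : K, ∀ n < 3, v.valuation (algebraMap K _ c * xFun W ^ n) <
        v.valuation (xFun W ^ 3) := by
      intro c n hn
      refine (valuation_const_mul_le v c _).trans_lt ?_
      rw [map_pow, map_pow]
      exact pow_lt_pow_right₀ hx hn
    exact Valuation.map_add_lt _ (Valuation.map_add_lt _ (hterm _ _ (by norm_num))
      (hterm _ _ (by norm_num))) (hterm _ _ (by norm_num))
  have hlin : v.valuation (aeval (xFun W) (linPoly W)) ≤ ξ := by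
    simp only [linPoly, map_add, map_mul, aeval_C, aeval_X]
    refine (Valuation.map_add _ _ _).trans (max_le (valuation_const_mul_le v _ _) ?_)
    exact (v.valuation_algebraMap_le_one _).trans hx.le
  have heq : yFun W ^ 2 + aeval (xFun W) (linPoly W) * yFun W =
      aeval (xFun W) (cubicPoly W) := by
    rw [yFun_sq]
    ring
  -- Once `y` dominates `x`, the term `y ^ 2` dominates its side of the Weierstrass equation and
  -- must match `x ^ 3`. This gives `η ^ 2 = ξ ^ 3`, and `ρ = η / ξ` is the common root.
  have hlt : ξ < η := by
    by_contra! h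
    have h1 : v.valuation (aeval (xFun W) (cubicPoly W)) ≤ ξ ^ 2 := by
      rw [← heq]
      refine (Valuation.map_add _ _ _).trans (max_le ?_ ?_)
      · rw [map_pow]
        exact pow_le_pow_left₀ zero_le h 2
      · rw [map_mul, sq]
        exact mul_le_mul' hlin h
    rw [hcub] at h1
    exact absurd h1 (pow_lt_pow_right₀ hx (by norm_num)).not_ge
  have hη0 : 0 < η := hξ0.trans hlt
  have hsq : η ^ 2 = ξ ^ 3 := by
    rw [← hcub, ← heq, Valuation.map_add_eq_of_lt_left, map_pow]
    rw [map_mul, map_pow, sq]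
    exact (mul_le_mul_left hlin _).trans_lt (mul_lt_mul_of_pos_right hlt hη0)
  refine ⟨η / ξ, (one_lt_div₀ hξ0).mpr hlt, ?_, ?_⟩
  · rw [div_pow, hsq]
    field_simp
  · rw [div_pow, pow_succ η, hsq]
    field_simp

theorem valuation_lt_of_infVal_lt {ρ : ℤᵐ⁰} (hρ : 1 < ρ) (hx : v.valuation (xFun W) = ρ ^ 2)
    (hy : v.valuation (yFun W) = ρ ^ 3) {r : W.toAffine.CoordinateRing} {N : ℕ}
    (h : infVal W (algebraMap _ _ r) < WithZero.exp (N : ℤ)) :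
    v.valuation (algebraMap _ _ r) < ρ ^ N := by
  have hρ0 : 0 < ρ := zero_lt_one.trans hρ
  obtain ⟨p, q, rfl⟩ := exists_eq_add_mul_yClass r
  rw [infVal_lt_exp_iff] at h
  rw [map_add, map_mul, algebraMap_xPoly, algebraMap_xPoly, ← yFun_eq, aeval_eq_sum_range,
    aeval_eq_sum_range, Finset.sum_mul]
  refine Valuation.map_add_lt _ ?_ ?_
  · refine Valuation.map_sum_lt _ (pow_pos hρ0 N).ne' fun i _ => ?_
    rw [Algebra.smul_def]
    by_cases hi : N ≤ 2 * i
    · rw [h.1 i hi, map_zero, zero_mul, map_zero]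
      exact pow_pos hρ0 N
    · refine (valuation_const_mul_le v _ _).trans_lt ?_
      rw [map_pow, hx, ← pow_mul]
      exact pow_lt_pow_right₀ hρ (by omega)
  · refine Valuation.map_sum_lt _ (pow_pos hρ0 N).ne' fun i _ => ?_
    rw [Algebra.smul_def, mul_assoc]
    by_cases hi : N ≤ 2 * i + 3
    · rw [h.2 i hi, map_zero, zero_mul, map_zero]
      exact pow_pos hρ0 N
    · refine (valuation_const_mul_le v _ _).trans_lt ?_
      rw [map_mul, map_pow, hx, hy, ← pow_mul, ← pow_add]
      exact pow_lt_pow_right₀ hρ (by omega)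

/-- Every natural number except `1` has the form `2 i + 3 j`. The value `1` is also never the degree
of a norm, so every non-zero element has a monomial of equal pole order. -/
theorem exists_monomial_of_ne_one {N : ℕ} (hN : N ≠ 1) :
    ∃ e : W.toAffine.CoordinateRing, infVal W (algebraMap _ _ e) = WithZero.exp (N : ℤ) ∧
      ∃ i j, algebraMap _ _ e = xFun W ^ i * yFun W ^ j ∧ N = 2 * i + 3 * j := by
  have key : ∀ i j, N = 2 * i + 3 * j → ∃ e : W.toAffine.CoordinateRing,
      infVal W (algebraMap _ _ e) = WithZero.exp (N : ℤ) ∧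
      ∃ i j, algebraMap _ _ e = xFun W ^ i * yFun W ^ j ∧ N = 2 * i + 3 * j := by
    intro i j h
    have he : algebraMap _ W.toAffine.FunctionField (xPoly W X ^ i * yClass W ^ j) =
        xFun W ^ i * yFun W ^ j := by
      rw [map_mul, map_pow, map_pow, ← xFun_eq, ← yFun_eq]
    refine ⟨xPoly W X ^ i * yClass W ^ j, ?_, i, j, he, h⟩
    rw [he, map_mul, map_pow, map_pow, infVal_xFun, infVal_yFun, ← WithZero.exp_nsmul,
      ← WithZero.exp_nsmul, ← WithZero.exp_add, h, WithZero.exp_inj]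
    simp
    ring
  rcases Nat.even_or_odd' N with ⟨n, h | h⟩
  · exact key n 0 (by omega)
  · exact key (n - 1) 1 (by omega)

/-- Subtracting a suitable non-zero constant multiple of a monomial of the same pole order lowers
the order of `r`. The remainder is then smaller at `v` as well, so `r` has the value of that
monomial. -/
theorem valuation_eq_of_one_lt {ρ : ℤᵐ⁰} (hρ : 1 < ρ) (hx : v.valuation (xFun W) = ρ ^ 2)
    (hy : v.valuation (yFun W) = ρ ^ 3) {r : W.toAffine.CoordinateRing} (hr : r ≠ 0) :
    v.valuation (algebraMap _ _ r) = ρ ^ normDeg r := by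
  obtain ⟨e, he, i, j, hij, hN⟩ :=
    exists_monomial_of_ne_one (W := W) (Affine.CoordinateRing.natDegree_norm_ne_one r)
  change infVal W (algebraMap _ _ e) = WithZero.exp (normDeg r : ℤ) at he
  change normDeg r = _ at hN
  have he0 : algebraMap _ W.toAffine.FunctionField e ≠ 0 := by
    intro h
    rw [h, map_zero] at he
    exact WithZero.exp_ne_zero he.symm
  have hve : v.valuation (algebraMap _ _ e) = ρ ^ normDeg r := by
    rw [hij, map_mul, map_pow, map_pow, hx, hy, hN, ← pow_mul, ← pow_mul, ← pow_add]
  have hr' := infVal_algebraMap hr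
  have h1 : infVal W (algebraMap _ _ r / algebraMap _ _ e) = 1 := by
    rw [map_div₀, hr', he, div_self WithZero.exp_ne_zero]
  obtain ⟨c, hc⟩ := infVal_exists_const_sub_lt_one h1.le
  have hc0 : c ≠ 0 := by
    rintro rfl
    rw [map_zero, sub_zero, h1] at hc
    exact lt_irrefl _ hc
  have h2 : infVal W (algebraMap _ _ (r - algebraMap K _ c * e)) <
      WithZero.exp (normDeg r : ℤ) := by
    rw [← he]
    have h3 := mul_lt_mul_of_pos_right hc
      (show 0 < infVal W (algebraMap _ _ e) from (Valuation.pos_iff _).mpr he0)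
    rw [one_mul, ← map_mul, sub_mul, div_mul_cancel₀ _ he0] at h3
    rwa [map_sub, map_mul, ← IsScalarTower.algebraMap_apply]
  have h4 := valuation_lt_of_infVal_lt v hρ hx hy h2
  have h5 : v.valuation (algebraMap _ _ (algebraMap K _ c * e)) = ρ ^ normDeg r := by
    rw [map_mul, ← IsScalarTower.algebraMap_apply, map_mul, v.valuation_const hc0, hve, one_mul]
  rw [← h5]
  apply Valuation.map_eq_of_sub_lt
  rwa [h5, ← map_sub]

theorem infVal_exists_uniformizer : ∃ t, infVal W t = WithZero.exp (-1) := by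
  refine ⟨xFun W / yFun W, ?_⟩
  rw [map_div₀, infVal_xFun, infVal_yFun, ← WithZero.exp_sub]
  norm_num

/-- On the coordinate ring `v` is `ρ ^ normDeg` with `ρ > 1`, while `infVal` is `exp normDeg`. Hence
a fraction integral for `infVal` is integral for `v`. -/
theorem eq_infVal_of_one_lt (hx : 1 < v.valuation (xFun W)) : infVal W = v.valuation := by
  refine valuation_eq_of_le_one infVal_exists_uniformizer v.exists_uniformizer fun f hf => ?_
  obtain ⟨ρ, hρ, hx, hy⟩ := valuation_xFun_yFun_of_one_lt v hx
  obtain ⟨a, b, hb, rfl⟩ := IsFractionRing.div_surjective (A := W.toAffine.CoordinateRing) f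
  have hb0 : b ≠ 0 := nonZeroDivisors.ne_zero hb
  rcases eq_or_ne a 0 with rfl | ha0
  · simp
  rw [map_div₀, infVal_algebraMap ha0, infVal_algebraMap hb0,
    div_le_one₀ WithZero.exp_pos, WithZero.exp_le_exp, Nat.cast_le] at hf
  rw [map_div₀, valuation_eq_of_one_lt v hρ hx hy ha0, valuation_eq_of_one_lt v hρ hx hy hb0,
    div_le_one₀ (pow_pos (zero_lt_one.trans hρ) _)]
  exact pow_le_pow_right₀ hρ.le hf

end PointsAtInfinity

/-! ### Valuations, values and divisors at rational points. -/

section RationalPoints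

variable {K : Type*} [Field K] {W : WeierstrassCurve K} [W.IsElliptic]

theorem exists_closedPoint_pointSpectrum (p : HeightOneSpectrum W.toAffine.CoordinateRing) :
    ∃ v : ClosedPoint K W.toAffine.FunctionField,
      v.valuation = p.valuation W.toAffine.FunctionField := by
  refine exists_closedPoint_valuation_eq _ (p.valuation_exists_uniformizer _) fun c => ?_
  rw [algebraMap_const]
  exact p.valuation_le_one _

theorem exists_closedPoint_ptVal (P : W.toAffine.Point) :
    ∃ v : ClosedPoint K W.toAffine.FunctionField, v.valuation = ptVal P := by
  cases P with
  | zero =>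
    refine exists_closedPoint_valuation_eq _ infVal_exists_uniformizer fun c => ?_
    rcases eq_or_ne c 0 with rfl | hc
    · simp
    · exact (infVal_const hc).le
  | some a b h => exact exists_closedPoint_pointSpectrum _

/-- Conditions on all closed points lying at `P` thereby become conditions on the single valuation
`ptVal P`. -/
theorem isAt_iff (v : ClosedPoint K W.toAffine.FunctionField) (P : W.toAffine.Point) :
    IsAt v P ↔ v.valuation = ptVal P := by
  cases P with
  | zero =>
    refine ⟨fun h => (eq_infVal_of_one_lt v h).symm, fun h => ?_⟩
    change 1 < v.valuation (xFun W)
    rw [h]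
    change 1 < infVal W (xFun W)
    rw [infVal_xFun, ← WithZero.exp_zero, WithZero.exp_lt_exp]
    norm_num
  | some a b h =>
    refine ⟨fun hv => (eq_ptVal_of_isAt_some v h hv.1 hv.2).symm, fun hv => ?_⟩
    change v.valuation _ < 1 ∧ v.valuation _ < 1
    rw [hv, ← algebraMap_XClass, ← algebraMap_YClass]
    exact ⟨((pointSpectrum h).valuation_lt_one_iff_mem _).mpr (Ideal.subset_span (by simp)),
      ((pointSpectrum h).valuation_lt_one_iff_mem _).mpr (Ideal.subset_span (by simp))⟩

omit [W.IsElliptic] in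
theorem eq_of_isAt {v : ClosedPoint K W.toAffine.FunctionField} {P Q : W.toAffine.Point}
    (hP : IsAt v P) (hQ : IsAt v Q) : P = Q := by
  have hsub : ∀ f : W.toAffine.FunctionField, ∀ a a' : K, v.valuation (f - algebraMap K _ a) < 1 →
      v.valuation (f - algebraMap K _ a') < 1 → a = a' := by
    intro f a a' h h'
    by_contra hne
    have h1 := v.valuation_const (sub_ne_zero.mpr hne)
    have h2 : algebraMap K W.toAffine.FunctionField (a - a') =
        (f - algebraMap K _ a') - (f - algebraMap K _ a) := by
      rw [map_sub]
      ring
    rw [h2] at h1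
    exact absurd h1 (Valuation.map_sub_lt _ h' h).ne
  cases P with
  | zero =>
    cases Q with
    | zero => rfl
    | some a b h => exact absurd hP (valuation_xFun_le_one_of_sub v hQ.1.le).not_gt
  | some a b h =>
    cases Q with
    | zero => exact absurd hQ (valuation_xFun_le_one_of_sub v hP.1.le).not_gt
    | some a' b' h' =>
      obtain rfl := hsub _ _ _ hP.1 hQ.1
      obtain rfl := hsub _ _ _ hP.2 hQ.2
      rfl

theorem ptVal_injective : Function.Injective (ptVal (W := W)) := by
  intro P Q h
  obtain ⟨v, hv⟩ := exists_closedPoint_ptVal P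
  exact eq_of_isAt ((isAt_iff v P).mpr hv) ((isAt_iff v Q).mpr (hv.trans h))

theorem ptVal_const (P : W.toAffine.Point) {c : K} (hc : c ≠ 0) :
    ptVal P (algebraMap K _ c) = 1 := by
  obtain ⟨v, hv⟩ := exists_closedPoint_ptVal P
  rw [← hv, v.valuation_const hc]

theorem ptVal_const_le_one (P : W.toAffine.Point) (c : K) :
    ptVal P (algebraMap K _ c) ≤ 1 := by
  obtain ⟨v, hv⟩ := exists_closedPoint_ptVal P
  rw [← hv]
  exact v.valuation_algebraMap_le_one c

/-- The residue field at a rational point is the field of constants. -/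
theorem exists_const_sub_lt_one (P : W.toAffine.Point) {f : W.toAffine.FunctionField}
    (hf : ptVal P f ≤ 1) : ∃ c : K, ptVal P (f - algebraMap K _ c) < 1 := by
  cases P with
  | zero => exact infVal_exists_const_sub_lt_one hf
  | some a b h =>
    obtain ⟨r, hr⟩ := (pointSpectrum h).exists_valuation_sub_lt_of_integer hf 1
    obtain ⟨c, hc⟩ := exists_const_sub_mem_XYIdeal h.1 r
    refine ⟨c, ?_⟩
    have h1 := ((pointSpectrum h).valuation_lt_one_iff_mem
      (K := W.toAffine.FunctionField) _).mpr hc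
    have : f - algebraMap K _ c = algebraMap _ _ (r - algebraMap K _ c) -
        (algebraMap _ W.toAffine.FunctionField r - f) := by
      rw [map_sub, ← IsScalarTower.algebraMap_apply]
      ring
    rw [this]
    exact Valuation.map_sub_lt _ h1 hr

theorem hasValueAt_iff (P : W.toAffine.Point) (f : W.toAffine.FunctionField) (c : K) :
    HasValueAt P f c ↔ ptVal P (f - algebraMap K _ c) < 1 := by
  constructor
  · intro h
    obtain ⟨v, hv⟩ := exists_closedPoint_ptVal P
    rw [← hv]
    exact h v ((isAt_iff v P).mpr hv)
  · intro h v hv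
    rwa [(isAt_iff v P).mp hv]

theorem HasValueAt.unique {P : W.toAffine.Point} {f : W.toAffine.FunctionField} {c c' : K}
    (h : HasValueAt P f c) (h' : HasValueAt P f c') : c = c' := by
  rw [hasValueAt_iff] at h h'
  by_contra hne
  have h1 := ptVal_const P (sub_ne_zero.mpr hne)
  have h2 : algebraMap K W.toAffine.FunctionField (c - c') =
      (f - algebraMap K _ c') - (f - algebraMap K _ c) := by
    rw [map_sub]
    ring
  rw [h2] at h1
  exact absurd h1 (Valuation.map_sub_lt _ h' h).ne

theorem HasValueAt.valueAt_eq {P : W.toAffine.Point} {f : W.toAffine.FunctionField} {c : K}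
    (h : HasValueAt P f c) : valueAt P f = c := by
  have hex : ∃ c, HasValueAt P f c := ⟨c, h⟩
  rw [valueAt, dif_pos hex]
  exact hex.choose_spec.unique h

theorem hasValueAt_valueAt {P : W.toAffine.Point} {f : W.toAffine.FunctionField}
    (h : ptVal P f ≤ 1) : HasValueAt P f (valueAt P f) := by
  obtain ⟨c, hc⟩ := exists_const_sub_lt_one P h
  rw [← hasValueAt_iff] at hc
  rwa [hc.valueAt_eq]

open Classical in
theorem pointsDivisor_apply (X : Set W.toAffine.Point) (v : ClosedPoint K W.toAffine.FunctionField) :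
    pointsDivisor X v = if ∃ x ∈ X, v.valuation = ptVal x then 1 else 0 := by
  rw [pointsDivisor]
  split_ifs with h
  · obtain ⟨x, hx, hv⟩ := h
    have : {y ∈ X | IsAt v y} = {x} := by
      ext y
      simp only [Set.mem_ofPred_eq, Set.mem_singleton_iff]
      constructor
      · rintro ⟨-, hy⟩
        exact eq_of_isAt hy ((isAt_iff v x).mpr hv)
      · rintro rfl
        exact ⟨hx, (isAt_iff v y).mpr hv⟩
    rw [this, Set.ncard_singleton]
    rfl
  · have : {y ∈ X | IsAt v y} = ∅ := by
      ext y
      simp only [Set.mem_ofPred_eq, Set.mem_empty_iff_false, iff_false]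
      rintro ⟨hy, hv⟩
      exact h ⟨y, hy, (isAt_iff v y).mp hv⟩
    rw [this, Set.ncard_empty]
    rfl

/-- `f ∈ L((X))` in terms of valuations. -/
theorem mem_riemannRochSpace_pointsDivisor (X : Set W.toAffine.Point)
    (f : W.toAffine.FunctionField) : f ∈ riemannRochSpace (pointsDivisor X) ↔
      (∀ x ∈ X, ptVal x f ≤ WithZero.exp 1) ∧
      ∀ v : ClosedPoint K W.toAffine.FunctionField, (∀ x ∈ X, v.valuation ≠ ptVal x) →
        v.valuation f ≤ 1 := by
  classical
  change (∀ v, _) ↔ _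
  simp only [pointsDivisor_apply]
  constructor
  · intro h
    refine ⟨fun x hx => ?_, fun v hv => ?_⟩
    · obtain ⟨v, hv⟩ := exists_closedPoint_ptVal x
      have := h v
      rwa [if_pos ⟨x, hx, hv⟩, hv] at this
    · have := h v
      rwa [if_neg (by rintro ⟨x, hx, h⟩; exact hv x hx h), WithZero.exp_zero] at this
  · rintro ⟨h1, h2⟩ v
    split_ifs with h
    · obtain ⟨x, hx, hv⟩ := h
      rw [hv]
      exact h1 x hx
    · rw [WithZero.exp_zero]
      exact h2 v fun x hx hv => h ⟨x, hx, hv⟩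

theorem ptVal_le_one_of_mem_riemannRochSpace {X : Set W.toAffine.Point}
    {f : W.toAffine.FunctionField} (hf : f ∈ riemannRochSpace (pointsDivisor X))
    {P : W.toAffine.Point} (hP : P ∉ X) : ptVal P f ≤ 1 := by
  obtain ⟨v, hv⟩ := exists_closedPoint_ptVal P
  rw [← hv]
  refine ((mem_riemannRochSpace_pointsDivisor X f).mp hf).2 v fun x hx h => ?_
  exact hP (ptVal_injective (hv.symm.trans h) ▸ hx)

end RationalPoints

/-! ### Local parameters and functions with two simple poles. -/

section LocalAnalysis

variable {K : Type*} [Field K] {W : WeierstrassCurve K}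

/-- The cofactor in `(y - b) (y - b') = (x - a) κ`, where `(a, b')` is the negative of `(a, b)`. -/
def cofactor (W : WeierstrassCurve K) (a : K) : W.toAffine.FunctionField :=
  xFun W ^ 2 + algebraMap K _ (a + W.a₂) * xFun W + algebraMap K _ (a ^ 2 + W.a₂ * a + W.a₄) -
    algebraMap K _ W.a₁ * yFun W

/-- The Weierstrass equation at `(x, y)` minus the one at `(a, b)`, with `x - a` factored out. -/
theorem sub_mul_sub_negY {a b : K} (h : W.toAffine.Equation a b) :
    (yFun W - algebraMap K _ b) * (yFun W - algebraMap K _ (W.toAffine.negY a b)) =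
      (xFun W - algebraMap K _ a) * cofactor W a := by
  have h1 := equation_xFun_yFun (W := W)
  have h2 := congrArg (algebraMap K W.toAffine.FunctionField)
    ((Affine.equation_iff (W := W.toAffine) a b).mp h)
  simp only [map_add, map_mul, map_pow] at h2
  simp only [cofactor, Affine.negY, map_sub, map_neg, map_add, map_mul, map_pow]
  linear_combination h1 - h2

variable (v : ClosedPoint K W.toAffine.FunctionField)

theorem valuation_cofactor_le_one (hx : v.valuation (xFun W) ≤ 1) (a : K) :
    v.valuation (cofactor W a) ≤ 1 := by
  have hc := v.valuation_algebraMap_le_one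
  have hy := valuation_yFun_le_one v hx
  rw [cofactor]
  refine (Valuation.map_sub _ _ _).trans (max_le ((Valuation.map_add _ _ _).trans (max_le
    ((Valuation.map_add _ _ _).trans (max_le ?_ ?_)) (hc _))) ?_)
  · rw [map_pow]
    exact pow_le_one' hx 2
  · rw [map_mul]
    exact mul_le_one' (hc _) hx
  · rw [map_mul]
    exact mul_le_one' (hc _) hy

theorem valuation_sub_const_le_one {f : W.toAffine.FunctionField} (hf : v.valuation f ≤ 1) (c : K) :
    v.valuation (f - algebraMap K _ c) ≤ 1 :=
  (Valuation.map_sub _ _ _).trans (max_le hf (v.valuation_algebraMap_le_one c))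

theorem valuation_sub_const_eq_one {f : W.toAffine.FunctionField} {c c' : K} (hc : c ≠ c')
    (hf : v.valuation (f - algebraMap K _ c) < 1) : v.valuation (f - algebraMap K _ c') = 1 := by
  have h1 := v.valuation_const (sub_ne_zero.mpr hc)
  have h2 : f - algebraMap K _ c' =
      (f - algebraMap K _ c) + algebraMap K W.toAffine.FunctionField (c - c') := by
    rw [map_sub]
    ring
  rw [h2, Valuation.map_add_eq_of_lt_right _ (by rwa [h1]), h1]

/-- At a point where the curve has a vertical tangent the cofactor does not vanish. -/
theorem valuation_cofactor_eq_one {a b : K} (h : W.toAffine.Nonsingular a b)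
    (hb : W.toAffine.negY a b = b) (hv : IsAt v (.some a b h)) :
    v.valuation (cofactor W a) = 1 := by
  have hx1 := valuation_xFun_le_one_of_sub v hv.1.le
  -- This is the value of the cofactor at `(a, b)` and, up to sign, the partial derivative in `x`.
  -- The partial derivative in `y` vanishes by `hb`, so nonsingularity makes `d` non-zero.
  set d : K := 3 * a ^ 2 + 2 * W.a₂ * a + W.a₄ - W.a₁ * b with hd
  have hd0 : d ≠ 0 := by
    have h2 := ((Affine.nonsingular_iff' (W := W.toAffine) a b).mp h).2
    rcases h2 with h2 | h2
    · intro h0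
      apply h2
      linear_combination h0 * (-1)
    · refine absurd ?_ h2
      rw [Affine.negY] at hb
      linear_combination -hb
  have key : cofactor W a = (xFun W - algebraMap K _ a) *
      (xFun W - algebraMap K _ (-(2 * a + W.a₂))) -
      algebraMap K _ W.a₁ * (yFun W - algebraMap K _ b) + algebraMap K _ d := by
    simp only [cofactor, hd, map_sub, map_neg, map_add, map_mul, map_pow, map_ofNat]
    ring
  rw [key, Valuation.map_add_eq_of_lt_right, v.valuation_const hd0]
  rw [v.valuation_const hd0]
  refine Valuation.map_sub_lt _ ?_ ?_
  · rw [map_mul]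
    exact (mul_le_of_le_one_right' (valuation_sub_const_le_one v hx1 _)).trans_lt hv.1
  · rw [map_mul]
    exact (mul_le_of_le_one_left' (v.valuation_algebraMap_le_one _)).trans_lt hv.2

/-- The maximal ideal at the point is generated by `x - a` and `y - b`. A uniformizer is a
combination of the two with regular coefficients, so one of them has order at most one. -/
theorem IsAt.max_valuation_eq [W.IsElliptic] {a b : K} {h : W.toAffine.Nonsingular a b}
    (hv : IsAt v (.some a b h)) :
    WithZero.exp (-1) ≤ max (v.valuation (xFun W - algebraMap K _ a))
      (v.valuation (yFun W - algebraMap K _ b)) := by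
  have hx1 := valuation_xFun_le_one_of_sub v hv.1.le
  obtain ⟨π, hπ⟩ := (pointSpectrum h).intValuation_exists_uniformizer
  have hvv := (isAt_iff v _).mp hv
  have hvπ : v.valuation (algebraMap _ _ π) = WithZero.exp (-1) := by
    rw [hvv, ← hπ]
    exact (pointSpectrum h).valuation_of_algebraMap π
  have hmem : π ∈ (pointSpectrum h).asIdeal := by
    rw [← (pointSpectrum h).intValuation_lt_one_iff_mem, hπ, ← WithZero.exp_zero,
      WithZero.exp_lt_exp]
    norm_num
  change π ∈ Ideal.span _ at hmem
  rw [Ideal.mem_span_pair] at hmem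
  obtain ⟨α, β, rfl⟩ := hmem
  rw [← hvπ, map_add, map_mul, map_mul, algebraMap_XClass, algebraMap_YClass]
  refine (Valuation.map_add _ _ _).trans (max_le_max ?_ ?_)
  · rw [map_mul]
    exact mul_le_of_le_one_left' (valuation_algebraMap_le_one v hx1 α)
  · rw [map_mul]
    exact mul_le_of_le_one_left' (valuation_algebraMap_le_one v hx1 β)

theorem le_exp_neg_one_of_lt_one {x : ℤᵐ⁰} (hx : x < 1) : x ≤ WithZero.exp (-1) := by
  rcases eq_or_ne x 0 with rfl | h
  · exact zero_le
  rw [← WithZero.exp_log h, ← WithZero.exp_zero, WithZero.exp_lt_exp] at hx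
  rw [← WithZero.exp_log h, WithZero.exp_le_exp]
  omega

theorem sub_xFun_ne_zero (a : K) : xFun W - algebraMap K _ a ≠ 0 := by
  rw [← algebraMap_XClass, Ne, map_eq_zero_iff _ (IsFractionRing.injective _ _)]
  exact Affine.CoordinateRing.XClass_ne_zero a

/-- If the point is not its own negative, then `x - a` is a uniformizer. -/
theorem IsAt.valuation_sub_xFun [W.IsElliptic] {a b : K} {h : W.toAffine.Nonsingular a b}
    (hv : IsAt v (.some a b h)) (hb : W.toAffine.negY a b ≠ b) :
    v.valuation (xFun W - algebraMap K _ a) = WithZero.exp (-1) := by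
  have hx1 := valuation_xFun_le_one_of_sub v hv.1.le
  refine le_antisymm (le_exp_neg_one_of_lt_one hv.1) ?_
  refine hv.max_valuation_eq.trans (max_le le_rfl ?_)
  have h1 := congrArg v.valuation (sub_mul_sub_negY h.1)
  rw [map_mul, map_mul, valuation_sub_const_eq_one v (Ne.symm hb) hv.2, mul_one] at h1
  rw [h1]
  exact mul_le_of_le_one_right' (valuation_cofactor_le_one v hx1 a)

/-- At a point that is its own negative, `y - b` is a uniformizer and `x - a` vanishes doubly. -/
theorem IsAt.valuation_sub_of_negY_eq [W.IsElliptic] {a b : K} {h : W.toAffine.Nonsingular a b}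
    (hv : IsAt v (.some a b h)) (hb : W.toAffine.negY a b = b) :
    v.valuation (xFun W - algebraMap K _ a) = WithZero.exp (-2) ∧
      v.valuation (yFun W - algebraMap K _ b) = WithZero.exp (-1) := by
  have h1 := congrArg v.valuation (sub_mul_sub_negY h.1)
  rw [hb, map_mul, map_mul, valuation_cofactor_eq_one v h hb hv, mul_one] at h1
  have hy : v.valuation (yFun W - algebraMap K _ b) = WithZero.exp (-1) := by
    refine le_antisymm (le_exp_neg_one_of_lt_one hv.2) ?_
    refine hv.max_valuation_eq.trans (max_le ?_ le_rfl)
    rw [← h1]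
    exact mul_le_of_le_one_left' hv.2.le
  refine ⟨?_, hy⟩
  rw [← h1, hy, ← WithZero.exp_add]
  norm_num

/-! ### Functions with two simple poles -/

/-- The function `(y - b') / (x - a)`, where `(a, b')` is the negative of the point `(a, b)`. It has
simple poles at `(a, b)` and at infinity. For the point at infinity, it is zero. -/
def poleFun : W.toAffine.Point → W.toAffine.FunctionField
  | .zero => 0
  | .some a b _ => (yFun W - algebraMap K _ (W.toAffine.negY a b)) / (xFun W - algebraMap K _ a)

/-- If the point is not its own negative, the numerator is a unit and the denominator a uniformizer.
Otherwise their orders are one and two. -/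
theorem poleFun_some_valuation [W.IsElliptic] {a b : K} (h : W.toAffine.Nonsingular a b)
    (hv : IsAt v (.some a b h)) :
    v.valuation (poleFun (.some a b h)) = WithZero.exp 1 := by
  rw [poleFun, map_div₀]
  by_cases hb : W.toAffine.negY a b = b
  · obtain ⟨h1, h2⟩ := hv.valuation_sub_of_negY_eq v hb
    rw [h1, hb, h2, ← WithZero.exp_sub]
    norm_num
  · rw [valuation_sub_const_eq_one v (Ne.symm hb) hv.2, hv.valuation_sub_xFun v hb,
      ← WithZero.exp_zero, ← WithZero.exp_sub]
    norm_num

/-- The only critical place is the negative of `P`, where `x - a` vanishes but `y - b` does not.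
There `sub_mul_sub_negY` rewrites the quotient as `cofactor / (y - b)`. -/
theorem poleFun_valuation_le_one (P : W.toAffine.Point) (h : ¬ IsAt v P)
    (hx : v.valuation (xFun W) ≤ 1) : v.valuation (poleFun P) ≤ 1 := by
  cases P with
  | zero => simp [poleFun]
  | some a b hab =>
    have hy := valuation_yFun_le_one v hx
    have hs0 : 0 < v.valuation (xFun W - algebraMap K _ a) := by
      rw [Valuation.pos_iff]
      exact sub_xFun_ne_zero a
    rcases (valuation_sub_const_le_one v hx a).lt_or_eq with hs | hs
    · have hu : v.valuation (yFun W - algebraMap K _ b) = 1 :=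
        (valuation_sub_const_le_one v hy b).lt_or_eq.resolve_left fun hu => h ⟨hs, hu⟩
      have h1 := congrArg v.valuation (sub_mul_sub_negY hab.1)
      rw [map_mul, map_mul, hu, one_mul] at h1
      rw [poleFun, map_div₀, div_le_one₀ hs0, h1]
      exact mul_le_of_le_one_right' (valuation_cofactor_le_one v hx a)
    · rw [poleFun, map_div₀, hs, div_one]
      exact valuation_sub_const_le_one v hy _

theorem infVal_sub_const {f : W.toAffine.FunctionField} (hf : 1 < infVal W f) (c : K) :
    infVal W (f - algebraMap K _ c) = infVal W f := by
  have hc : infVal W (algebraMap K _ c) ≤ 1 := by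
    rcases eq_or_ne c 0 with rfl | hc
    · simp
    · exact (infVal_const hc).le
  rw [Valuation.map_sub_eq_of_lt_left _ (hc.trans_lt hf)]

theorem one_lt_infVal_xFun : 1 < infVal W (xFun W) := by
  rw [infVal_xFun, ← WithZero.exp_zero, WithZero.exp_lt_exp]
  norm_num

theorem one_lt_infVal_yFun : 1 < infVal W (yFun W) := by
  rw [infVal_yFun, ← WithZero.exp_zero, WithZero.exp_lt_exp]
  norm_num

theorem infVal_poleFun {a b : K} (h : W.toAffine.Nonsingular a b) :
    infVal W (poleFun (.some a b h)) = WithZero.exp 1 := by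
  rw [poleFun, map_div₀, infVal_sub_const one_lt_infVal_yFun, infVal_sub_const one_lt_infVal_xFun,
    infVal_xFun, infVal_yFun, ← WithZero.exp_sub]
  norm_num

/-- The functions `poleFun` have the same polar part `y / x` at infinity. -/
theorem infVal_poleFun_sub {a b : K} (h : W.toAffine.Nonsingular a b) :
    infVal W (poleFun (.some a b h) - yFun W / xFun W) < 1 := by
  have hs := sub_xFun_ne_zero (W := W) a
  have hx := xFun_ne_zero (W := W)
  have : poleFun (.some a b h) - yFun W / xFun W =
      (algebraMap K _ a * yFun W - algebraMap K _ (W.toAffine.negY a b) * xFun W) /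
        ((xFun W - algebraMap K _ a) * xFun W) := by
    rw [poleFun]
    field_simp
    ring
  have hc : ∀ c : K, infVal W (algebraMap K _ c) ≤ 1 := by
    intro c
    rcases eq_or_ne c 0 with rfl | hc
    · simp
    · exact (infVal_const hc).le
  rw [this, map_div₀, map_mul, infVal_sub_const one_lt_infVal_xFun, infVal_xFun,
    ← WithZero.exp_add, div_lt_one₀ WithZero.exp_pos]
  refine Valuation.map_sub_lt _ ?_ ?_
  · rw [map_mul, infVal_yFun]
    refine (mul_le_of_le_one_left' (hc _)).trans_lt ?_
    rw [WithZero.exp_lt_exp]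
    norm_num
  · rw [map_mul, infVal_xFun]
    refine (mul_le_of_le_one_left' (hc _)).trans_lt ?_
    rw [WithZero.exp_lt_exp]
    norm_num

variable [W.IsElliptic]

/-- For `P ≠ Q` the function `poleFun P - poleFun Q` has a simple pole at `P`. -/
theorem ptVal_poleFun_sub {P Q : W.toAffine.Point} (hPQ : P ≠ Q) :
    ptVal P (poleFun P - poleFun Q) = WithZero.exp 1 := by
  obtain ⟨v, hv⟩ := exists_closedPoint_ptVal P
  have hvP := (isAt_iff v P).mpr hv
  cases P with
  | zero =>
    cases Q with
    | zero => exact absurd rfl hPQ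
    | some a b h =>
      rw [show poleFun (W := W) .zero = 0 from rfl, zero_sub, Valuation.map_neg]
      exact infVal_poleFun h
  | some a b h =>
    have h1 := poleFun_some_valuation v h hvP
    have h2 := poleFun_valuation_le_one v Q (fun hQ => hPQ (eq_of_isAt hvP hQ))
      (valuation_xFun_le_one_of_sub v hvP.1.le)
    rw [← hv, Valuation.map_sub_eq_of_lt_left, h1]
    rw [h1]
    refine h2.trans_lt ?_
    rw [← WithZero.exp_zero, WithZero.exp_lt_exp]
    norm_num

omit [W.IsElliptic] in
/-- The function `poleFun P - poleFun Q` has no poles outside of `P` and `Q`. -/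
theorem valuation_poleFun_sub_le_one {P Q : W.toAffine.Point} (hP : ¬ IsAt v P)
    (hQ : ¬ IsAt v Q) : v.valuation (poleFun P - poleFun Q) ≤ 1 := by
  by_cases hx : v.valuation (xFun W) ≤ 1
  · exact (Valuation.map_sub _ _ _).trans (max_le (poleFun_valuation_le_one v P hP hx)
      (poleFun_valuation_le_one v Q hQ hx))
  · push Not at hx
    have hv : IsAt v .zero := hx
    cases P with
    | zero => exact absurd hv hP
    | some a b h =>
      cases Q with
      | zero => exact absurd hv hQ
      | some a' b' h' =>
        rw [← eq_infVal_of_one_lt v hx]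
        have : poleFun (.some a b h) - poleFun (.some a' b' h') =
            (poleFun (.some a b h) - yFun W / xFun W) -
              (poleFun (.some a' b' h') - yFun W / xFun W) := by ring
        rw [this]
        exact (Valuation.map_sub_lt _ (infVal_poleFun_sub h) (infVal_poleFun_sub h')).le

theorem poleFun_sub_mem_riemannRochSpace {P Q : W.toAffine.Point} (hPQ : P ≠ Q)
    {X : Set W.toAffine.Point} (hP : P ∈ X) (hQ : Q ∈ X) :
    poleFun P - poleFun Q ∈ riemannRochSpace (pointsDivisor X) := by
  rw [mem_riemannRochSpace_pointsDivisor]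
  have key : ∀ v : ClosedPoint K W.toAffine.FunctionField, ¬ IsAt v P → ¬ IsAt v Q →
      v.valuation (poleFun P - poleFun Q) ≤ 1 := fun v => valuation_poleFun_sub_le_one v
  refine ⟨fun x hx => ?_, fun v hv => key v (fun h => hv P hP ((isAt_iff v P).mp h))
    (fun h => hv Q hQ ((isAt_iff v Q).mp h))⟩
  by_cases hxP : x = P
  · rw [hxP, ptVal_poleFun_sub hPQ]
  by_cases hxQ : x = Q
  · rw [hxQ, Valuation.map_sub_swap, ptVal_poleFun_sub (Ne.symm hPQ)]
  obtain ⟨v, hv⟩ := exists_closedPoint_ptVal x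
  have hvx := (isAt_iff v x).mpr hv
  rw [← hv]
  refine (key v (fun h => hxP (eq_of_isAt hvx h)) (fun h => hxQ (eq_of_isAt hvx h))).trans ?_
  rw [← WithZero.exp_zero, WithZero.exp_le_exp]
  norm_num

end LocalAnalysis

/-! ### Point ideals and the ideal class group. -/

section PointIdeals

variable {K : Type*} [Field K] {W : WeierstrassCurve K}

/-- The ideal of a rational point in the coordinate ring (the unit ideal for the point at
infinity). -/
def ptIdeal : W.toAffine.Point → Ideal W.toAffine.CoordinateRing
  | .zero => 1
  | .some a b _ => Affine.CoordinateRing.XYIdeal W.toAffine a (C b)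

/-- The polynomial `X - a` for the point `(a, b)`, and `1` for the point at infinity. -/
def ptPoly : W.toAffine.Point → K[X]
  | .zero => 1
  | .some a _ _ => X - C a

/-- The degree of the ideal of a rational point. -/
def ptDeg : W.toAffine.Point → ℕ
  | .zero => 0
  | .some _ _ _ => 1

theorem ptDeg_neg (P : W.toAffine.Point) : ptDeg (-P) = ptDeg P := by
  cases P <;> rfl

theorem ptPoly_monic (P : W.toAffine.Point) : (ptPoly P).Monic := by
  cases P with
  | zero => exact monic_one
  | some a b h => exact monic_X_sub_C a

theorem natDegree_ptPoly (P : W.toAffine.Point) : (ptPoly P).natDegree = ptDeg P := by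
  cases P with
  | zero => exact natDegree_one
  | some a b h => exact natDegree_X_sub_C a

theorem ptIdeal_mul_ptIdeal_neg (P : W.toAffine.Point) :
    ptIdeal P * ptIdeal (-P) = Ideal.span {xPoly W (ptPoly P)} := by
  cases P with
  | zero =>
    change 1 * 1 = Ideal.span {xPoly W 1}
    rw [xPoly, map_one, Ideal.span_singleton_one, mul_one, Ideal.one_eq_top]
  | some a b h =>
    rw [mul_comm]
    exact Affine.CoordinateRing.XYIdeal_neg_mul h

theorem map_conj_ptIdeal_le (P : W.toAffine.Point) :
    (ptIdeal P).map (conj W) ≤ ptIdeal (-P) := by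
  cases P with
  | zero =>
    change _ ≤ (1 : Ideal W.toAffine.CoordinateRing)
    rw [Ideal.one_eq_top]
    exact le_top
  | some a b h =>
    change Ideal.map (conj W) (Ideal.span {_, _}) ≤ Ideal.span {_, _}
    rw [Ideal.map_span, Ideal.span_le]
    rintro _ ⟨r, hr, rfl⟩
    rw [SetLike.mem_coe, Ideal.mem_span_pair]
    have hX : Affine.CoordinateRing.XClass W.toAffine a = xPoly W (X - C a) := rfl
    have hY : ∀ b, Affine.CoordinateRing.YClass W.toAffine (C b) = yClass W - xPoly W (C b) := by
      intro b
      rw [Affine.CoordinateRing.YClass, map_sub]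
      rfl
    rcases hr with rfl | hr
    · exact ⟨1, 0, by rw [hX, conj_xPoly]; ring⟩
    · rw [Set.mem_singleton_iff] at hr
      subst hr
      refine ⟨-xPoly W (C W.a₁), -1, ?_⟩
      rw [hX, hY, hY, map_sub, conj_xPoly, conj_yClass]
      simp only [Affine.negY, linPoly, map_sub, map_neg, map_add, map_mul]
      ring

variable {ι : Type*}

theorem conj_mem_prod_ptIdeal_neg (s : Finset ι) (P : ι → W.toAffine.Point)
    {r : W.toAffine.CoordinateRing} (hr : r ∈ ∏ i ∈ s, ptIdeal (P i)) :
    conj W r ∈ ∏ i ∈ s, ptIdeal (-P i) := by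
  have h1 : (∏ i ∈ s, ptIdeal (P i)).map (conj W) = ∏ i ∈ s, (ptIdeal (P i)).map (conj W) :=
    map_prod (Ideal.mapHom (conj W)) _ _
  have h2 : ∏ i ∈ s, (ptIdeal (P i)).map (conj W) ≤ ∏ i ∈ s, ptIdeal (-P i) :=
    Finset.prod_le_prod' fun i _ => map_conj_ptIdeal_le (P i)
  exact h2 (h1 ▸ Ideal.mem_map_of_mem (conj W) hr)

theorem isUnit_of_normDeg_eq_zero {r : W.toAffine.CoordinateRing} (hr : r ≠ 0)
    (h : normDeg r = 0) : IsUnit r := by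
  have hu : IsUnit (Algebra.norm K[X] r) := by
    rw [Polynomial.isUnit_iff_degree_eq_zero, degree_eq_natDegree (norm_ne_zero hr)]
    exact congrArg Nat.cast h
  have := hu.map (algebraMap K[X] W.toAffine.CoordinateRing)
  rw [show algebraMap K[X] W.toAffine.CoordinateRing (Algebra.norm K[X] r) = r * conj W r from
    (mul_conj r).symm] at this
  exact isUnit_of_mul_isUnit_left this

/-- An element of a product of point ideals whose norm has the least possible degree generates
this product. -/
theorem span_eq_prod_ptIdeal [W.IsElliptic] (s : Finset ι) (P : ι → W.toAffine.Point)
    {r : W.toAffine.CoordinateRing} (hr0 : r ≠ 0) (hr : r ∈ ∏ i ∈ s, ptIdeal (P i))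
    (hdeg : normDeg r ≤ ∑ i ∈ s, ptDeg (P i)) :
    Ideal.span {r} = ∏ i ∈ s, ptIdeal (P i) := by
  set I := ∏ i ∈ s, ptIdeal (P i) with hI
  set I' := ∏ i ∈ s, ptIdeal (-P i) with hI'
  have hr' := conj_mem_prod_ptIdeal_neg s P hr
  have hII : I * I' = Ideal.span {xPoly W (∏ i ∈ s, ptPoly (P i))} := by
    rw [hI, hI', ← Finset.prod_mul_distrib, xPoly, map_prod, ← Ideal.prod_span_singleton]
    exact Finset.prod_congr rfl fun i _ => ptIdeal_mul_ptIdeal_neg (P i)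
  have hM : (∏ i ∈ s, ptPoly (P i)).Monic := monic_prod_of_monic _ _ fun i _ => ptPoly_monic _
  have hMdeg : (∏ i ∈ s, ptPoly (P i)).natDegree = ∑ i ∈ s, ptDeg (P i) := by
    rw [natDegree_prod_of_monic _ _ fun i _ => ptPoly_monic _]
    exact Finset.sum_congr rfl fun i _ => natDegree_ptPoly _
  have hM0 : xPoly W (∏ i ∈ s, ptPoly (P i)) ≠ 0 := by
    rw [Ne, map_eq_zero_iff _ xPoly_injective]
    exact hM.ne_zero
  -- The norm `r * conj r` lies in `I * I'`, which is generated by the product of the `X - a_i`.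
  obtain ⟨t, ht⟩ : ∃ t, xPoly W (Algebra.norm K[X] r) = xPoly W (∏ i ∈ s, ptPoly (P i)) * t := by
    rw [← mul_conj]
    have := Ideal.mul_mem_mul hr hr'
    rw [hII, Ideal.mem_span_singleton] at this
    exact this
  have ht0 : t ≠ 0 := by
    rintro rfl
    rw [mul_zero, map_eq_zero_iff _ xPoly_injective] at ht
    exact norm_ne_zero hr0 ht
  -- By `hdeg` the degree of the norm of `r` is no larger than that of its divisor, so the cofactor
  -- has degree zero.
  have htu : IsUnit t := by
    apply isUnit_of_normDeg_eq_zero ht0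
    have h1 := congrArg normDeg ht
    rw [normDeg_mul hM0 ht0, normDeg_xPoly, normDeg_xPoly, hMdeg] at h1
    have h2 : (Algebra.norm K[X] r).natDegree ≤ ∑ i ∈ s, ptDeg (P i) := hdeg
    omega
  obtain ⟨J, hJ⟩ := Ideal.dvd_iff_le.mpr ((Ideal.span_singleton_le_iff_mem I).mpr hr)
  obtain ⟨J', hJ'⟩ := Ideal.dvd_iff_le.mpr ((Ideal.span_singleton_le_iff_mem I').mpr hr')
  -- With `(r) = I J` and `(conj r) = I' J'`, cancelling `I I'` leaves `J J' = 1`.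
  have hJJ : I * I' * (J * J') = I * I' * 1 := by
    rw [mul_mul_mul_comm, ← hJ, ← hJ', Ideal.span_singleton_mul_span_singleton, mul_conj, ht, hII,
      mul_one, Ideal.span_singleton_mul_right_unit htu]
  have hII0 : I * I' ≠ 0 := by
    rw [hII, Ideal.zero_eq_bot, Ne, Ideal.span_singleton_eq_bot]
    exact hM0
  have h1 : J * J' = 1 := mul_left_cancel₀ hII0 hJJ
  have h2 : J = 1 := by
    rw [Ideal.one_eq_top] at h1 ⊢
    exact top_le_iff.mp (h1.ge.trans Ideal.mul_le_left)
  rw [hJ, h2, mul_one]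

/-- The class of the product of point ideals is the image of the sum of the points under the
homomorphism `toClass`, whose injectivity turns principality into a vanishing sum. -/
theorem exists_unit_prod_ptIdeal [DecidableEq K] (s : Finset ι) (P : ι → W.toAffine.Point) :
    ∃ U : (FractionalIdeal (nonZeroDivisors W.toAffine.CoordinateRing) W.toAffine.FunctionField)ˣ,
      (U : FractionalIdeal (nonZeroDivisors W.toAffine.CoordinateRing) W.toAffine.FunctionField) =
        ((∏ i ∈ s, ptIdeal (P i) : Ideal W.toAffine.CoordinateRing) :
          FractionalIdeal (nonZeroDivisors W.toAffine.CoordinateRing) W.toAffine.FunctionField) ∧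
      Affine.Point.toClass (∑ i ∈ s, P i) =
        Additive.ofMul (ClassGroup.mk W.toAffine.FunctionField U) := by
  classical
  induction s using Finset.induction_on with
  | empty => exact ⟨1, by simp, by simp⟩
  | insert i s hi ih =>
    obtain ⟨U, hU, hUc⟩ := ih
    have h1 : ∃ V : (FractionalIdeal (nonZeroDivisors W.toAffine.CoordinateRing)
        W.toAffine.FunctionField)ˣ,
        (V : FractionalIdeal (nonZeroDivisors W.toAffine.CoordinateRing) W.toAffine.FunctionField) =
          (ptIdeal (P i) : Ideal W.toAffine.CoordinateRing) ∧
        Affine.Point.toClass (P i) =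
          Additive.ofMul (ClassGroup.mk W.toAffine.FunctionField V) := by
      cases P i with
      | zero =>
        refine ⟨1, ?_, ?_⟩
        · rw [Units.val_one]
          exact (FractionalIdeal.coeIdealHom (nonZeroDivisors W.toAffine.CoordinateRing)
            W.toAffine.FunctionField).map_one.symm
        · rw [map_one, ofMul_one]
          rfl
      | some a b h => exact ⟨Affine.CoordinateRing.XYIdeal' h, rfl, rfl⟩
    obtain ⟨V, hV, hVc⟩ := h1
    refine ⟨V * U, ?_, ?_⟩
    · rw [Finset.prod_insert hi, FractionalIdeal.coeIdeal_mul, Units.val_mul, hU, hV]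
    · rw [Finset.sum_insert hi, map_add, hUc, hVc, map_mul, ofMul_mul]

/-- If a product of point ideals is principal, then the points add up to zero. -/
theorem sum_eq_zero_of_span_eq [DecidableEq K] (s : Finset ι) (P : ι → W.toAffine.Point)
    {r : W.toAffine.CoordinateRing} (hr0 : r ≠ 0)
    (h : Ideal.span {r} = ∏ i ∈ s, ptIdeal (P i)) : ∑ i ∈ s, P i = 0 := by
  obtain ⟨U, hU, hUc⟩ := exists_unit_prod_ptIdeal s P
  rw [← Affine.Point.toClass_eq_zero, hUc,
    (ClassGroup.mk_eq_one_of_coe_ideal hU).mpr ⟨r, hr0, h.symm⟩, ofMul_one]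

end PointIdeals

/-! ### Abel's theorem. -/

section ZerosAndPoles

variable {K : Type*} [Field K] {W : WeierstrassCurve K} [W.IsElliptic] [DecidableEq K]

/-- The function `x - x(A)` vanishes at `A` and `-A`, and doubly if these coincide; the two
indicators then add up to two. Infinity is excluded because `x` has a pole there. -/
theorem ptVal_xPoly_ptPoly_le {P : W.toAffine.Point} (hP : P ≠ 0) (A : W.toAffine.Point) :
    ptVal P (algebraMap _ _ (xPoly W (ptPoly A))) ≤
      WithZero.exp (-((if A = P then 1 else 0) + (if A = -P then 1 else 0) : ℤ)) := by
  obtain ⟨v, hv⟩ := exists_closedPoint_ptVal P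
  have hvP := (isAt_iff v P).mpr hv
  cases P with
  | zero => exact absurd rfl hP
  | some a b h =>
    cases A with
    | zero =>
      rw [if_neg (by rintro ⟨⟩), if_neg (by rintro ⟨⟩), ptPoly, xPoly, map_one, map_one, map_one]
      simp
    | some a' b' h' =>
      have hx1 := valuation_xFun_le_one_of_sub v hvP.1.le
      have hx : algebraMap W.toAffine.CoordinateRing W.toAffine.FunctionField
          (xPoly W (ptPoly (.some a' b' h'))) = xFun W - algebraMap K _ a' := algebraMap_XClass a'
      rw [hx, ← hv]
      by_cases h1 : (Affine.Point.some a' b' h' : W.toAffine.Point) = .some a b h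
      · obtain ⟨rfl, rfl⟩ : a' = a ∧ b' = b := by simpa using h1
        rw [if_pos rfl]
        by_cases h2 : W.toAffine.negY a' b' = b'
        · rw [(hvP.valuation_sub_of_negY_eq v h2).1, WithZero.exp_le_exp]
          split_ifs <;> norm_num
        · rw [hvP.valuation_sub_xFun v h2, if_neg, add_zero]
          rw [Affine.Point.neg_some]
          intro h3
          apply h2
          have : a' = a' ∧ b' = W.toAffine.negY a' b' := by
            simpa only [Affine.Point.some.injEq] using h3
          exact this.2.symm
      · rw [if_neg h1, zero_add]
        split_ifs with h2
        · rw [Affine.Point.neg_some] at h2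
          have : a' = a ∧ b' = W.toAffine.negY a b := by
            simpa only [Affine.Point.some.injEq] using h2
          rw [this.1]
          exact le_exp_neg_one_of_lt_one hvP.1
        · rw [neg_zero, WithZero.exp_zero]
          exact valuation_sub_const_le_one v hx1 a'

theorem prod_exp {ι : Type*} (s : Finset ι) (n : ι → ℤ) :
    ∏ i ∈ s, WithZero.exp (n i) = WithZero.exp (∑ i ∈ s, n i) := by
  classical
  induction s using Finset.induction_on with
  | empty => simp
  | insert i s hi ih => rw [Finset.prod_insert hi, Finset.sum_insert hi, ih, WithZero.exp_add]

/-- The order of a function in `L((X))` vanishing on `Z` is bounded from below. -/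
theorem ptVal_le_of_mem_of_vanish {X Z : Finset W.toAffine.Point} (hXZ : Disjoint Z X)
    {f : W.toAffine.FunctionField}
    (hf : f ∈ riemannRochSpace (pointsDivisor (X : Set W.toAffine.Point)))
    (hZ : ∀ z ∈ Z, ptVal z f < 1) (P : W.toAffine.Point) :
    ptVal P f ≤ WithZero.exp ((if P ∈ X then 1 else 0) - (if P ∈ Z then 1 else 0) : ℤ) := by
  split_ifs with h1 h2 h2
  · exact absurd h1 (Finset.disjoint_left.mp hXZ h2)
  · rw [sub_zero]
    exact ((mem_riemannRochSpace_pointsDivisor _ _).mp hf).1 P h1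
  · rw [zero_sub]
    exact le_exp_neg_one_of_lt_one (hZ P h2)
  · rw [sub_zero, WithZero.exp_zero]
    exact ptVal_le_one_of_mem_riemannRochSpace hf h1

/-- The product of a function in `L((X))` and all `x - x(A)` for `A ∈ X` lies in the coordinate
ring. -/
theorem exists_algebraMap_eq_mul_prod {X : Finset W.toAffine.Point}
    {f : W.toAffine.FunctionField}
    (hf : f ∈ riemannRochSpace (pointsDivisor (X : Set W.toAffine.Point))) :
    ∃ r, algebraMap W.toAffine.CoordinateRing W.toAffine.FunctionField r =
      f * ∏ A ∈ X, algebraMap _ _ (xPoly W (ptPoly A)) := by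
  refine HeightOneSpectrum.mem_integers_of_valuation_le_one W.toAffine.FunctionField _ fun p => ?_
  obtain ⟨v, hv⟩ := exists_closedPoint_pointSpectrum p
  have hint : ∀ r : W.toAffine.CoordinateRing, v.valuation (algebraMap _ W.toAffine.FunctionField r) ≤ 1 := by
    intro r
    rw [hv]
    exact p.valuation_le_one r
  rw [← hv, map_mul, map_prod]
  by_cases h : ∃ P ∈ X, v.valuation = ptVal P
  · obtain ⟨P, hPX, hP⟩ := h
    have hP0 : P ≠ 0 := by
      rintro rfl
      have h1 := hint (xPoly W Polynomial.X)
      rw [← xFun_eq] at h1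
      have h2 : 1 < v.valuation (xFun W) := (isAt_iff v 0).mpr hP
      exact h2.not_ge h1
    -- The factor `x - x(P)` absorbs the simple pole of `f` at `P`; all other factors are integral.
    rw [← Finset.mul_prod_erase X _ hPX, ← mul_assoc]
    refine mul_le_one' ?_ (Finset.prod_le_one' fun A _ => hint _)
    have h1 := ((mem_riemannRochSpace_pointsDivisor _ _).mp hf).1 P hPX
    have h2 := ptVal_xPoly_ptPoly_le hP0 P
    rw [if_pos rfl] at h2
    rw [hP]
    refine (mul_le_mul' h1 h2).trans ?_
    rw [← WithZero.exp_add, ← WithZero.exp_zero, WithZero.exp_le_exp]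
    split_ifs <;> norm_num
  · refine mul_le_one' ?_ (Finset.prod_le_one' fun A _ => hint _)
    exact ((mem_riemannRochSpace_pointsDivisor _ _).mp hf).2 v fun x hx hvx => h ⟨x, hx, hvx⟩

omit [DecidableEq K] in
theorem isCoprime_ptIdeal {P Q : W.toAffine.Point} (h : P ≠ Q) :
    IsCoprime (ptIdeal P) (ptIdeal Q) := by
  cases P with
  | zero => exact isCoprime_one_left
  | some a b hab =>
    cases Q with
    | zero => exact isCoprime_one_right
    | some a' b' hab' =>
      have := (pointSpectrum hab).isMaximal
      have := (pointSpectrum hab').isMaximal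
      change IsCoprime (pointSpectrum hab).asIdeal (pointSpectrum hab').asIdeal
      refine Ideal.isCoprime_of_isMaximal fun h' => h (ptVal_injective ?_)
      change (pointSpectrum hab).valuation _ = (pointSpectrum hab').valuation _
      rw [HeightOneSpectrum.ext h']

omit [DecidableEq K] in
theorem ptIdeal_pow_dvd (P : W.toAffine.Point) {r : W.toAffine.CoordinateRing} {n : ℕ}
    (h : P ≠ 0 → ptVal P (algebraMap _ _ r) ≤ WithZero.exp (-(n : ℤ))) :
    ptIdeal P ^ n ∣ Ideal.span {r} := by
  cases P with
  | zero =>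
    change 1 ^ n ∣ _
    rw [one_pow]
    exact one_dvd _
  | some a b hab =>
    have h1 := h (by rintro ⟨⟩)
    change (pointSpectrum hab).asIdeal ^ n ∣ _
    rw [← HeightOneSpectrum.intValuation_le_pow_iff_dvd, ← HeightOneSpectrum.valuation_of_algebraMap
      (K := W.toAffine.FunctionField)]
    exact h1

omit [W.IsElliptic] [DecidableEq K] in
theorem infVal_xPoly_ptPoly (P : W.toAffine.Point) :
    infVal W (algebraMap _ _ (xPoly W (ptPoly P))) = WithZero.exp (2 * ptDeg P : ℤ) := by
  rw [infVal_algebraMap, normDeg_xPoly, natDegree_ptPoly]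
  · push_cast
    rfl
  · rw [Ne, map_eq_zero_iff _ xPoly_injective]
    exact (ptPoly_monic P).ne_zero

omit [W.IsElliptic] in
theorem ptDeg_eq (P : W.toAffine.Point) : (ptDeg P : ℤ) = 1 - if P = 0 then 1 else 0 := by
  cases P with
  | zero =>
    rw [if_pos Affine.Point.zero_def.symm]
    rfl
  | some a b h =>
    rw [if_neg (Affine.Point.some_ne_zero h)]
    simp [ptDeg]

omit [W.IsElliptic] in
theorem sum_ptDeg (X : Finset W.toAffine.Point) :
    ∑ P ∈ X, (ptDeg P : ℤ) = X.card - if (0 : W.toAffine.Point) ∈ X then 1 else 0 := by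
  simp only [ptDeg_eq, Finset.sum_sub_distrib, Finset.sum_ite_eq']
  simp

/-- **Abel's theorem**, one direction, for divisors of the form `(Z) - (X)`: if a non-zero function
in `L((X))` vanishes on a set `Z` disjoint from `X` and of the same size, then `Z` and `X` have the
same sum in the group of rational points. -/
theorem sum_eq_sum_of_vanish {X Z : Finset W.toAffine.Point} (hXZ : Disjoint Z X)
    (hcard : Z.card = X.card) {f : W.toAffine.FunctionField} (hf0 : f ≠ 0)
    (hf : f ∈ riemannRochSpace (pointsDivisor (X : Set W.toAffine.Point)))
    (hZ : ∀ z ∈ Z, ptVal z f < 1) : ∑ z ∈ Z, z = ∑ x ∈ X, x := by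
  obtain ⟨r, hr⟩ := exists_algebraMap_eq_mul_prod hf
  have hxne : ∀ A : W.toAffine.Point,
      algebraMap W.toAffine.CoordinateRing W.toAffine.FunctionField (xPoly W (ptPoly A)) ≠ 0 := by
    intro A
    rw [Ne, map_eq_zero_iff _ (IsFractionRing.injective _ _), map_eq_zero_iff _ xPoly_injective]
    exact (ptPoly_monic A).ne_zero
  have hr0 : r ≠ 0 := by
    rintro rfl
    rw [map_zero, eq_comm, mul_eq_zero, Finset.prod_eq_zero_iff] at hr
    rcases hr with h | ⟨A, -, h⟩
    · exact hf0 h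
    · exact hxne A h
  -- The factors `x - x(A)` cancel the poles of `f` on `X` and add zeros on `-X`.
  set X' : Finset W.toAffine.Point := X.map (Equiv.neg _).toEmbedding with hX'
  have hmemX' : ∀ P, P ∈ X' ↔ -P ∈ X := by
    intro P
    rw [hX', Finset.mem_map_equiv]
    rfl
  have hval : ∀ P : W.toAffine.Point, P ≠ 0 → ptVal P (algebraMap _ _ r) ≤
      WithZero.exp (-((if P ∈ Z then 1 else 0) + (if P ∈ X' then 1 else 0) : ℤ)) := by
    intro P hP
    have h1 : ∏ A ∈ X, ptVal P (algebraMap _ _ (xPoly W (ptPoly A))) ≤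
        WithZero.exp (-((if P ∈ X then 1 else 0) + (if P ∈ X' then 1 else 0) : ℤ)) := by
      refine (Finset.prod_le_prod' fun A _ => ptVal_xPoly_ptPoly_le hP A).trans ?_
      rw [prod_exp, WithZero.exp_le_exp, Finset.sum_neg_distrib, Finset.sum_add_distrib,
        Finset.sum_ite_eq', Finset.sum_ite_eq']
      simp only [hmemX', le_refl]
    rw [hr, map_mul, map_prod]
    refine (mul_le_mul' (ptVal_le_of_mem_of_vanish hXZ hf hZ P) h1).trans ?_
    rw [← WithZero.exp_add, WithZero.exp_le_exp]
    linarith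
  -- A disjoint sum is needed because `Z` and `-X` may overlap; a common point must count twice.
  have hmem : r ∈ ∏ i ∈ Z.disjSum X', ptIdeal (Sum.elim id id i) := by
    rw [← Ideal.span_singleton_le_iff_mem, ← Ideal.dvd_iff_le, Finset.prod_disjSum]
    simp only [Sum.elim_inl, Sum.elim_inr, id]
    -- Both products become powers indexed by `Z ∪ X'`. Distinct point ideals are coprime, so
    -- divisibility can be tested one point at a time.
    have hT : ∀ Y ⊆ Z ∪ X', ∏ P ∈ Y, ptIdeal P =
        ∏ P ∈ Z ∪ X', ptIdeal P ^ (if P ∈ Y then 1 else 0) := by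
      intro Y hY
      rw [← Finset.prod_subset hY fun P _ hP => by rw [if_neg hP, pow_zero]]
      exact Finset.prod_congr rfl fun P hP => by rw [if_pos hP, pow_one]
    rw [hT Z Finset.subset_union_left, hT X' Finset.subset_union_right, ← Finset.prod_mul_distrib]
    simp only [← pow_add]
    refine Finset.prod_dvd_of_coprime (fun P _ Q _ hPQ => (isCoprime_ptIdeal hPQ).pow) fun P _ => ?_
    refine ptIdeal_pow_dvd P fun hP => ?_
    push_cast
    exact hval P hP
  have hinf : infVal W f ≤ WithZero.exp ((if (0 : W.toAffine.Point) ∈ X then 1 else 0) -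
      (if (0 : W.toAffine.Point) ∈ Z then 1 else 0) : ℤ) := ptVal_le_of_mem_of_vanish hXZ hf hZ 0
  -- The product contributes `2 (|X| - [0 ∈ X])` to the pole order at infinity and `f` at most `[0 ∈
  -- X] - [0 ∈ Z]`. As `|Z| = |X|`, the total is the number of affine points in `Z` and `-X`.
  have hdeg : normDeg r ≤ ∑ i ∈ Z.disjSum X', ptDeg (Sum.elim id id i) := by
    have h1 := congrArg (infVal W) hr
    rw [infVal_algebraMap hr0, map_mul, map_prod] at h1
    simp only [infVal_xPoly_ptPoly, prod_exp] at h1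
    have h2 : WithZero.exp (normDeg r : ℤ) ≤ _ := h1.le.trans (mul_le_mul_left hinf _)
    rw [← WithZero.exp_add, WithZero.exp_le_exp, ← Finset.mul_sum, sum_ptDeg] at h2
    have h3 : (∑ i ∈ Z.disjSum X', (ptDeg (Sum.elim id id i) : ℤ)) =
        (Z.card - if (0 : W.toAffine.Point) ∈ Z then 1 else 0) +
        (X.card - if (0 : W.toAffine.Point) ∈ X then 1 else 0) := by
      rw [Finset.sum_disjSum, ← sum_ptDeg, ← sum_ptDeg, hX', Finset.sum_map]
      congr 1
      exact Finset.sum_congr rfl fun A _ => congrArg Nat.cast (ptDeg_neg A)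
    have h4 : (normDeg r : ℤ) ≤ ∑ i ∈ Z.disjSum X', (ptDeg (Sum.elim id id i) : ℤ) := by
      rw [h3, hcard]
      rw [hcard.symm] at h2
      linarith
    exact_mod_cast h4
  have hsum := sum_eq_zero_of_span_eq _ _ hr0 (span_eq_prod_ptIdeal _ _ hr0 hmem hdeg)
  rw [Finset.sum_disjSum, hX', Finset.sum_map] at hsum
  simp only [Sum.elim_inl, Sum.elim_inr, id, Equiv.coe_toEmbedding, Equiv.neg_apply] at hsum
  rw [← sub_eq_zero, sub_eq_add_neg, ← Finset.sum_neg_distrib]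
  exact hsum

end ZerosAndPoles

/-! ### Spans of parts of a linearly independent family. -/

section LinearAlgebra

variable {K V ι : Type*} [Field K] [AddCommGroup V] [Module K V]

theorem disjoint_span_image_of_linearIndepOn {b : ι → V} {S T T' : Set ι}
    (hb : LinearIndepOn K b S) (hT : T ⊆ S) (hT' : T' ⊆ S) (hd : Disjoint T T') :
    Disjoint (Submodule.span K (b '' T)) (Submodule.span K (b '' T')) := by
  have key : ∀ U ⊆ S, b '' U = (fun x : S => b x) '' (Subtype.val ⁻¹' U) := by
    intro U hU
    ext y
    constructor
    · rintro ⟨x, hx, rfl⟩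
      exact ⟨⟨x, hU hx⟩, hx, rfl⟩
    · rintro ⟨x, hx, rfl⟩
      exact ⟨x, hx, rfl⟩
  rw [key T hT, key T' hT']
  exact LinearIndependent.disjoint_span_image hb (hd.preimage _)

theorem finrank_span_image_of_linearIndepOn {b : ι → V} {T : Finset ι}
    (hb : LinearIndepOn K b (T : Set ι)) :
    Module.finrank K (Submodule.span K (b '' (T : Set ι))) = T.card := by
  have h := finrank_span_eq_card (b := fun x : (T : Set ι) => b x) hb
  rw [Set.image_eq_range, h]
  simp

end LinearAlgebra

/-! ### A basis of `L₀((X))` and the direct sum decomposition. -/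

section Basis

variable {K : Type*} [Field K] {W : WeierstrassCurve K} [W.IsElliptic]

theorem mem_L0_iff {X : Set W.toAffine.Point} {P : W.toAffine.Point}
    {f : W.toAffine.FunctionField} : f ∈ L0 (pointsDivisor X) P ↔
      f ∈ riemannRochSpace (pointsDivisor X) ∧ ptVal P f < 1 := by
  change _ ∧ HasValueAt P f 0 ↔ _
  rw [hasValueAt_iff, map_zero, sub_zero]

theorem algebraMap_mem_riemannRochSpace (X : Set W.toAffine.Point) (c : K) :
    algebraMap K _ c ∈ riemannRochSpace (pointsDivisor X) := by
  rw [mem_riemannRochSpace_pointsDivisor]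
  refine ⟨fun x _ => (ptVal_const_le_one x c).trans ?_, fun v _ => v.valuation_algebraMap_le_one c⟩
  rw [← WithZero.exp_zero, WithZero.exp_le_exp]
  norm_num

theorem riemannRochSpace_mono {X Y : Set W.toAffine.Point} (h : X ⊆ Y) :
    riemannRochSpace (pointsDivisor X) ≤ riemannRochSpace (pointsDivisor Y) := by
  intro f hf
  rw [mem_riemannRochSpace_pointsDivisor] at hf ⊢
  refine ⟨fun x hx => ?_, fun v hv => hf.2 v fun x hx => hv x (h hx)⟩
  by_cases hxX : x ∈ X
  · exact hf.1 x hxX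
  · refine (ptVal_le_one_of_mem_riemannRochSpace
      ((mem_riemannRochSpace_pointsDivisor _ _).mpr hf) hxX).trans ?_
    rw [← WithZero.exp_zero, WithZero.exp_le_exp]
    norm_num

theorem L0_mono {X Y : Set W.toAffine.Point} (h : X ⊆ Y) (P : W.toAffine.Point) :
    L0 (pointsDivisor X) P ≤ L0 (pointsDivisor Y) P :=
  fun _ hf => ⟨riemannRochSpace_mono h hf.1, hf.2⟩

/-- The function with simple poles at `A` and `Q` that vanishes at `P`. -/
def basisFun (Q P A : W.toAffine.Point) : W.toAffine.FunctionField :=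
  poleFun A - poleFun Q - algebraMap K _ (valueAt P (poleFun A - poleFun Q))

theorem basisFun_mem_L0 {Q P A : W.toAffine.Point} (hAQ : A ≠ Q) (hAP : A ≠ P) (hQP : Q ≠ P)
    {X : Set W.toAffine.Point} (hA : A ∈ X) (hQ : Q ∈ X) :
    basisFun Q P A ∈ L0 (pointsDivisor X) P := by
  rw [mem_L0_iff]
  refine ⟨sub_mem (poleFun_sub_mem_riemannRochSpace hAQ hA hQ)
    (algebraMap_mem_riemannRochSpace X _), ?_⟩
  have h : ptVal P (poleFun A - poleFun Q) ≤ 1 :=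
    ptVal_le_one_of_mem_riemannRochSpace
      (poleFun_sub_mem_riemannRochSpace hAQ (X := {A, Q}) (by simp) (by simp))
      (by simp [hAP.symm, hQP.symm])
  exact (hasValueAt_iff _ _ _).mp (hasValueAt_valueAt h)

theorem one_lt_exp_one : (1 : ℤᵐ⁰) < WithZero.exp 1 := by
  rw [← WithZero.exp_zero, WithZero.exp_lt_exp]
  norm_num

theorem ptVal_basisFun_self {Q P A : W.toAffine.Point} (hAQ : A ≠ Q) :
    ptVal A (basisFun Q P A) = WithZero.exp 1 := by
  rw [basisFun, Valuation.map_sub_eq_of_lt_left, ptVal_poleFun_sub hAQ]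
  rw [ptVal_poleFun_sub hAQ]
  exact (ptVal_const_le_one _ _).trans_lt one_lt_exp_one

theorem ptVal_basisFun_le_one {Q P A B : W.toAffine.Point} (hAQ : A ≠ Q) (hBA : B ≠ A)
    (hBQ : B ≠ Q) : ptVal B (basisFun Q P A) ≤ 1 := by
  refine (Valuation.map_sub _ _ _).trans (max_le ?_ (ptVal_const_le_one _ _))
  exact ptVal_le_one_of_mem_riemannRochSpace
      (poleFun_sub_mem_riemannRochSpace hAQ (X := {A, Q}) (by simp) (by simp))
      (by simp [hBA, hBQ])

theorem ptVal_smul_le (P : W.toAffine.Point) (c : K) (f : W.toAffine.FunctionField) :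
    ptVal P (c • f) ≤ ptVal P f := by
  rw [Algebra.smul_def, map_mul]
  exact mul_le_of_le_one_left' (ptVal_const_le_one P c)

/-- Among these functions only the one attached to `B` has a pole at `B`, so its coefficient in a
relation must vanish. -/
theorem linearIndepOn_basisFun (Q P : W.toAffine.Point) :
    LinearIndepOn K (basisFun Q P) {A | A ≠ Q} := by
  classical
  rw [linearIndepOn_iff']
  intro t g ht hsum B hB
  by_contra hg
  have h1 : ptVal B (g B • basisFun Q P B) = WithZero.exp 1 := by
    rw [Algebra.smul_def, map_mul, ptVal_const B hg, one_mul, ptVal_basisFun_self (ht hB)]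
  rw [← Finset.add_sum_erase _ _ hB, add_eq_zero_iff_eq_neg] at hsum
  rw [hsum, Valuation.map_neg] at h1
  have h2 : ptVal B (∑ A ∈ t.erase B, g A • basisFun Q P A) ≤ 1 := by
    refine Valuation.map_sum_le _ fun A hA => ?_
    rw [Finset.mem_erase] at hA
    exact (ptVal_smul_le _ _ _).trans (ptVal_basisFun_le_one (ht hA.2) hA.1.symm (ht hB))
  rw [h1] at h2
  exact absurd one_lt_exp_one h2.not_gt

/-- A non-zero element would have at most a simple pole at `Q` and a zero at `P`; Abel's theorem
would give `P = Q`. This starts the induction for the spanning statement. -/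
theorem L0_singleton_eq_bot {Q P : W.toAffine.Point} (hQP : Q ≠ P) :
    L0 (pointsDivisor {Q}) P = ⊥ := by
  classical
  rw [eq_bot_iff]
  intro f hf
  rw [Submodule.mem_bot]
  by_contra hf0
  rw [mem_L0_iff] at hf
  have h := sum_eq_sum_of_vanish (X := {Q}) (Z := {P}) (by simpa using hQP.symm) (by simp) hf0
    (by simpa using hf.1) (by simpa using hf.2)
  simp only [Finset.sum_singleton] at h
  exact hQP h.symm

/-- The functions `basisFun Q P A` for `A ∈ X \ {Q}` span `L₀((X))`. -/
theorem L0_eq_span {X : Finset W.toAffine.Point} {Q P : W.toAffine.Point} (hQ : Q ∈ X)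
    (hP : P ∉ X) : L0 (pointsDivisor (X : Set W.toAffine.Point)) P =
      Submodule.span K (basisFun Q P '' {A | A ∈ X ∧ A ≠ Q}) := by
  classical
  have hne : ∀ A ∈ X, A ≠ P := fun A hA h => hP (h ▸ hA)
  apply le_antisymm
  -- Induction on a set `T` of points other than `Q` that contains all poles of `f` in `X \ {Q}`.
  -- For empty `T` only a pole at `Q` is possible, and then `f = 0`.
  · have key : ∀ T : Finset W.toAffine.Point, T ⊆ X.erase Q → ∀ f ∈ L0 (pointsDivisor
        (X : Set W.toAffine.Point)) P, (∀ A ∈ X.erase Q, A ∉ T → ptVal A f ≤ 1) →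
        f ∈ Submodule.span K (basisFun Q P '' {A | A ∈ X ∧ A ≠ Q}) := by
      intro T
      induction T using Finset.induction_on with
      | empty =>
        intro _ f hf hA
        have hf0 : f ∈ L0 (pointsDivisor {Q}) P := by
          rw [mem_L0_iff, mem_riemannRochSpace_pointsDivisor] at hf ⊢
          refine ⟨⟨fun x hx => ?_, fun v hv => ?_⟩, hf.2⟩
          · rw [Set.mem_singleton_iff.mp hx]
            exact hf.1.1 Q hQ
          · by_cases h : ∃ x ∈ X, v.valuation = ptVal x
            · obtain ⟨x, hx, hvx⟩ := h
              rw [hvx]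
              refine hA x (Finset.mem_erase.mpr ⟨?_, hx⟩) (Finset.notMem_empty _)
              rintro rfl
              exact hv x rfl hvx
            · exact hf.1.2 v fun x hx hvx => h ⟨x, hx, hvx⟩
        rw [L0_singleton_eq_bot (hne Q hQ), Submodule.mem_bot] at hf0
        rw [hf0]
        exact zero_mem _
      | insert A T hAT ih =>
        intro hT f hf hval
        have hA := hT (Finset.mem_insert_self A T)
        rw [Finset.mem_erase] at hA
        set b := basisFun Q P A with hb
        have hbA : ptVal A b = WithZero.exp 1 := ptVal_basisFun_self hA.1
        have hb0 : b ≠ 0 := by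
          intro h
          rw [h, map_zero] at hbA
          exact WithZero.exp_ne_zero hbA.symm
        have hbmem : b ∈ L0 (pointsDivisor (X : Set W.toAffine.Point)) P :=
          basisFun_mem_L0 hA.1 (hne A hA.2) (hne Q hQ) hA.2 hQ
        -- The residue `c` of `f / b` at `A` is the coefficient of `b` whose subtraction removes the
        -- pole of `f` at `A`.
        have h1 : ptVal A (f / b) ≤ 1 := by
          rw [map_div₀, hbA, div_le_one₀ WithZero.exp_pos]
          exact ((mem_riemannRochSpace_pointsDivisor _ _).mp hf.1).1 A hA.2
        obtain ⟨c, hc⟩ := exists_const_sub_lt_one A h1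
        have h2 : ptVal A (f - c • b) ≤ 1 := by
          have : f - c • b = (f / b - algebraMap K _ c) * b := by
            rw [Algebra.smul_def, sub_mul, div_mul_cancel₀ _ hb0]
          rw [this, map_mul, hbA]
          calc _ ≤ WithZero.exp (-1) * WithZero.exp 1 := by
                gcongr
                exact le_exp_neg_one_of_lt_one hc
            _ = 1 := by
                rw [← WithZero.exp_add]
                simp
        have h3 := ih ((Finset.subset_insert A T).trans hT) (f - c • b)
          (sub_mem hf (Submodule.smul_mem _ c hbmem)) (fun B hB hBT => by
            by_cases hBA : B = A
            · rw [hBA]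
              exact h2
            · refine (Valuation.map_sub _ _ _).trans (max_le (hval B hB ?_) ?_)
              · rw [Finset.mem_insert, not_or]
                exact ⟨hBA, hBT⟩
              · exact (ptVal_smul_le _ _ _).trans
                  (ptVal_basisFun_le_one hA.1 hBA (Finset.mem_erase.mp hB).1))
        have h4 : c • b ∈ Submodule.span K (basisFun Q P '' {A | A ∈ X ∧ A ≠ Q}) :=
          Submodule.smul_mem _ c (Submodule.subset_span ⟨A, ⟨hA.2, hA.1⟩, rfl⟩)
        have := add_mem h3 h4
        rwa [sub_add_cancel] at this
    intro f hf
    exact key (X.erase Q) le_rfl f hf fun A hA hA' => absurd hA hA'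
  · rw [Submodule.span_le]
    rintro _ ⟨A, ⟨hA, hAQ⟩, rfl⟩
    exact basisFun_mem_L0 hAQ (hne A hA) (hne Q hQ) hA hQ

omit [W.IsElliptic] in
theorem setOf_mem_and_ne [DecidableEq K] (X : Finset W.toAffine.Point) (Q : W.toAffine.Point) :
    {A | A ∈ X ∧ A ≠ Q} = ((X.erase Q : Finset W.toAffine.Point) : Set W.toAffine.Point) := by
  ext A
  simp [and_comm]

/-- **Riemann–Roch** for `L₀((X))`. -/
theorem finrank_L0 {X : Finset W.toAffine.Point} {Q P : W.toAffine.Point} (hQ : Q ∈ X)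
    (hP : P ∉ X) :
    Module.finrank K (L0 (pointsDivisor (X : Set W.toAffine.Point)) P) + 1 = X.card := by
  classical
  rw [L0_eq_span hQ hP, setOf_mem_and_ne, finrank_span_image_of_linearIndepOn,
    Finset.card_erase_add_one hQ]
  refine (linearIndepOn_basisFun Q P).mono fun A hA => ?_
  exact (Finset.mem_erase.mp hA).1

theorem finiteDimensional_L0 {X : Finset W.toAffine.Point} {Q P : W.toAffine.Point} (hQ : Q ∈ X)
    (hP : P ∉ X) :
    FiniteDimensional K (L0 (pointsDivisor (X : Set W.toAffine.Point)) P) := by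
  classical
  rw [L0_eq_span hQ hP, setOf_mem_and_ne]
  exact FiniteDimensional.span_of_finite K ((Finset.finite_toSet _).image _)

/-- The decomposition of `L₀((X))` for a union of sets that meet in a single point. -/
theorem isInternal_L0 {ι : Type*} [DecidableEq ι] [Nonempty ι] {X : Finset W.toAffine.Point}
    {Y : ι → Finset W.toAffine.Point} {Q P : W.toAffine.Point} (hQ : ∀ i, Q ∈ Y i) (hP : P ∉ X)
    (hY : ∀ i j, i ≠ j → ∀ A, A ∈ Y i → A ∈ Y j → A = Q) (hX : ∀ A, A ∈ X ↔ ∃ i, A ∈ Y i) :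
    DirectSum.IsInternal fun i =>
      (L0 (pointsDivisor (Y i : Set W.toAffine.Point)) P).submoduleOf
        (L0 (pointsDivisor (X : Set W.toAffine.Point)) P) := by
  have hYX : ∀ i, Y i ⊆ X := fun i A hA => (hX A).mpr ⟨i, hA⟩
  have hmono : ∀ i, L0 (pointsDivisor (Y i : Set W.toAffine.Point)) P ≤
      L0 (pointsDivisor (X : Set W.toAffine.Point)) P := fun i => L0_mono (hYX i) P
  have hQX : Q ∈ X := hYX (Classical.arbitrary ι) (hQ _)
  have hspan : ∀ i, L0 (pointsDivisor (Y i : Set W.toAffine.Point)) P =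
      Submodule.span K (basisFun Q P '' {A | A ∈ Y i ∧ A ≠ Q}) :=
    fun i => L0_eq_span (hQ i) fun h => hP (hYX i h)
  have hmap : ∀ i, ((L0 (pointsDivisor (Y i : Set W.toAffine.Point)) P).submoduleOf
      (L0 (pointsDivisor (X : Set W.toAffine.Point)) P)).map (Submodule.subtype _) =
      L0 (pointsDivisor (Y i : Set W.toAffine.Point)) P := by
    intro i
    rw [Submodule.submoduleOf, Submodule.map_comap_subtype, inf_eq_right.mpr (hmono i)]
  rw [DirectSum.isInternal_submodule_iff_iSupIndep_and_iSup_eq_top]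
  constructor
  · intro i
    -- The sets `Y j \ {Q}` are pairwise disjoint, so they index disjoint parts of one linearly
    -- independent family.
    have hd : Disjoint (Submodule.span K (basisFun Q P '' {A | A ∈ Y i ∧ A ≠ Q}))
        (Submodule.span K (basisFun Q P '' ⋃ j, ⋃ (_ : j ≠ i), {A | A ∈ Y j ∧ A ≠ Q})) := by
      refine disjoint_span_image_of_linearIndepOn (linearIndepOn_basisFun Q P)
        (fun A hA => hA.2) ?_ ?_
      · refine Set.iUnion₂_subset fun j _ A hA => hA.2
      · rw [Set.disjoint_left]
        intro A hA hA'
        obtain ⟨j, hj, hAj⟩ := Set.mem_iUnion₂.mp hA'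
        exact hA.2 (hY i j hj.symm A hA.1 hAj.1)
    rw [Submodule.disjoint_def] at hd ⊢
    intro f hf hf'
    apply Subtype.ext
    refine hd f ?_ ?_
    · rw [← hspan i]
      exact hf
    · have h1 := Submodule.mem_map_of_mem (f := Submodule.subtype _) hf'
      simp only [Submodule.map_iSup, hmap] at h1
      simp only [hspan] at h1
      simp only [Set.image_iUnion, Submodule.span_iUnion]
      exact h1
  · apply Submodule.map_injective_of_injective (Submodule.subtype_injective _)
    rw [Submodule.map_top, Submodule.range_subtype, Submodule.map_iSup]
    simp only [hmap]
    simp only [hspan]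
    rw [L0_eq_span hQX hP, ← Submodule.span_iUnion, ← Set.image_iUnion]
    congr 2
    ext A
    simp only [Set.mem_iUnion, Set.mem_ofPred_eq, hX A]
    exact ⟨fun ⟨i, h⟩ => ⟨⟨i, h.1⟩, h.2⟩, fun ⟨⟨i, h⟩, h'⟩ => ⟨i, h, h'⟩⟩

end Basis

/-! ### A criterion for MDS codes. -/

section Codes

variable {K C T : Type*} [Field K] [AddCommGroup C] [Module K C] [Fintype T]

/-- A linear map all of whose non-zero values have fewer zeros than the dimension of the source is
an MDS code. -/
theorem isMDS_of_card_zeros_lt [FiniteDimensional K C] (e : C →ₗ[K] T → K)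
    (hT : Module.finrank K C ≤ Fintype.card T)
    (h : ∀ x, x ≠ 0 → ∀ Z : Finset T, (∀ t ∈ Z, e x t = 0) → Z.card < Module.finrank K C) :
    IsMDS (e : C → T → K) := by
  classical
  have hinj : Function.Injective e := by
    rw [← LinearMap.ker_eq_bot, LinearMap.ker_eq_bot']
    intro x hx
    by_contra hx0
    have h1 := h x hx0 Finset.univ fun t _ => congrFun hx t
    rw [Finset.card_univ] at h1
    omega
  have hsum : ∀ x, hammingNorm (e x) + (Finset.univ.filter fun t => e x t = 0).card =
      Fintype.card T := by
    intro x
    rw [hammingNorm, add_comm, Finset.card_filter_add_card_filter_not, Finset.card_univ]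
  have hzeros : ∀ x, x ≠ 0 →
      (Finset.univ.filter fun t => e x t = 0).card < Module.finrank K C :=
    fun x hx => h x hx _ fun t ht => (Finset.mem_filter.mp ht).2
  refine ⟨⟨e.isLinear, hinj⟩, fun hC => ?_⟩
  have hpos : 0 < Module.finrank K C := Module.finrank_pos
  refine ⟨Fintype.card T + 1 - Module.finrank K C, ⟨?_, ?_⟩, by omega⟩
  -- Vanishing on `dim C - 1` coordinates leaves a non-zero solution `x`. By `h` it has no further
  -- zeros, so its weight is exactly the bound.
  · obtain ⟨U, -, hU⟩ := Finset.exists_subset_card_eq (s := (Finset.univ : Finset T))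
      (n := Module.finrank K C - 1) (by rw [Finset.card_univ]; omega)
    let g : C →ₗ[K] U → K := LinearMap.pi fun t => (LinearMap.proj (t : T)).comp e
    have hg : LinearMap.ker g ≠ ⊥ := by
      apply LinearMap.ker_ne_bot_of_finrank_lt
      rw [Module.finrank_fintype_fun_eq_card, Fintype.card_coe, hU]
      omega
    obtain ⟨x, hx, hx0⟩ := (Submodule.ne_bot_iff _).mp hg
    refine ⟨e x, ⟨x, rfl⟩, fun h0 => hx0 (hinj (by rw [h0, map_zero])), ?_⟩
    have h1 : U ⊆ Finset.univ.filter fun t => e x t = 0 := by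
      intro t ht
      rw [Finset.mem_filter]
      exact ⟨Finset.mem_univ t, congrFun (LinearMap.mem_ker.mp hx) ⟨t, ht⟩⟩
    have h2 := Finset.card_le_card h1
    have h3 := hzeros x hx0
    have h4 := hsum x
    have h5 : Fintype.card T + 1 - Module.finrank K C = hammingNorm (e x) := by omega
    convert h5
  · rintro w ⟨_, ⟨x, rfl⟩, hx, rfl⟩
    have h3 := hzeros x (by rintro rfl; exact hx (map_zero e))
    have h4 := hsum x
    have h5 : Fintype.card T + 1 - Module.finrank K C ≤ hammingNorm (e x) := by omega
    convert h5

open Classical in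
theorem IsMDS.comp_linearEquiv {C' : Type*} [AddCommGroup C'] [Module K C'] {e : C → T → K}
    (he : IsMDS e) (l : C' ≃ₗ[K] C) : IsMDS (fun x => e (l x)) where
  isCode :=
    { linear :=
        { map_add := fun x y => by rw [map_add, he.isCode.linear.map_add]
          map_smul := fun c x => by rw [map_smul, he.isCode.linear.map_smul] }
      injective := he.isCode.injective.comp l.injective }
  singleton_eq := fun _ => by
    have hw : weights (fun x => e (l x)) = weights e := by
      unfold weights
      rw [show Set.range (fun x => e (l x)) = Set.range e from l.surjective.range_comp e]
    rw [hw, l.finrank_eq]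
    exact he.singleton_eq l.symm.toEquiv.nontrivial

theorem IsMDS.submoduleOf {V : Type*} [AddCommGroup V] [Module K V] {A B : Submodule K V}
    (hAB : A ≤ B) (g : V → T → K) (hg : IsMDS (fun x : A => g x)) :
    IsMDS (fun x : A.submoduleOf B => g (x : B)) :=
  hg.comp_linearEquiv (Submodule.submoduleOfEquivOfLe hAB)

end Codes

theorem mem_punctured {K : Type*} [Field K] {W : WeierstrassCurve K}
    {S : Finset W.toAffine.Point} {P s : W.toAffine.Point} :
    s ∈ punctured S P ↔ s ≠ P ∧ s ∈ S := by
  classical exact Finset.mem_erase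

/-! ### Evaluation codes on generic sets. -/

section EvaluationCodes

variable {K : Type*} [Field K] [DecidableEq K] {W : WeierstrassCurve K} [W.IsElliptic]

/-- The set `S` is generic with respect to the set `Y` of rational points: it is disjoint from `Y`
and no subset of `S` of the same size as `Y` has the same sum as `Y`. -/
structure IsGeneric (S Y : Finset W.toAffine.Point) : Prop where
  disjoint : Disjoint S Y
  sum_ne : ∀ T ⊆ S, T.card = Y.card → ∑ t ∈ T, t ≠ ∑ y ∈ Y, y

variable {S Y : Finset W.toAffine.Point} {P Q : W.toAffine.Point}

/-- If there were too many zeros, `Z` together with `P` would contain a set of exactly `|Y|` zeros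
in `S`. Abel's theorem would give it the sum of `Y`, against genericity. The `+ 1` counts the zero
at `P`. -/
theorem IsGeneric.card_zeros_lt (hS : IsGeneric S Y) (hP : P ∈ S) {f : W.toAffine.FunctionField}
    (hf : f ∈ L0 (pointsDivisor (Y : Set W.toAffine.Point)) P) (hf0 : f ≠ 0)
    {Z : Finset W.toAffine.Point} (hZS : Z ⊆ S.erase P) (hZ : ∀ z ∈ Z, ptVal z f < 1) :
    Z.card + 1 < Y.card := by
  by_contra! h
  have hPZ : P ∉ Z := fun hPZ => (Finset.mem_erase.mp (hZS hPZ)).1 rfl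
  rw [← Finset.card_insert_of_notMem hPZ] at h
  obtain ⟨T, hT, hTcard⟩ := Finset.exists_subset_card_eq h
  have hTS : T ⊆ S := hT.trans (Finset.insert_subset hP (hZS.trans (Finset.erase_subset P S)))
  rw [mem_L0_iff] at hf
  refine hS.sum_ne T hTS hTcard (sum_eq_sum_of_vanish (hS.disjoint.mono_left hTS) hTcard hf0 hf.1
    fun z hz => ?_)
  rcases Finset.mem_insert.mp (hT hz) with rfl | hz
  · exact hf.2
  · exact hZ z hz

/-- Evaluation on `S \ {P}` of a space of functions in `L₀((Y))` of the same dimension is MDS. -/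
theorem IsGeneric.isMDS_evaluation (hS : IsGeneric S Y) (hP : P ∈ S)
    (hcard : Y.card < S.card) {C : Type*} [AddCommGroup C] [Module K C] [FiniteDimensional K C]
    (φ : C →ₗ[K] W.toAffine.FunctionField) (hφ : Function.Injective φ)
    (hmem : ∀ x, φ x ∈ L0 (pointsDivisor (Y : Set W.toAffine.Point)) P)
    (hfin : Module.finrank K C + 1 = Y.card) :
    IsMDS (fun (x : C) (s : punctured S P) => valueAt (s : W.toAffine.Point) (φ x)) := by
  -- The poles lie in `Y`, which is disjoint from `S`, so `valueAt` never takes its default value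
  -- and is additive here.
  have hval : ∀ x, ∀ s ∈ S, HasValueAt s (φ x) (valueAt s (φ x)) := fun x s hs =>
    hasValueAt_valueAt (ptVal_le_one_of_mem_riemannRochSpace (mem_L0_iff.mp (hmem x)).1
      (Finset.disjoint_left.mp hS.disjoint hs))
  have hsS : ∀ s : punctured S P, (s : W.toAffine.Point) ∈ S := fun s => (mem_punctured.mp s.2).2
  let e : C →ₗ[K] punctured S P → K :=
    { toFun := fun x s => valueAt (s : W.toAffine.Point) (φ x)
      map_add' := by
        intro x y
        ext s
        have h1 := (hasValueAt_iff _ _ _).mp (hval x s (hsS s))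
        have h2 := (hasValueAt_iff _ _ _).mp (hval y s (hsS s))
        refine HasValueAt.valueAt_eq ((hasValueAt_iff _ _ _).mpr ?_)
        rw [Pi.add_apply, map_add, map_add, add_sub_add_comm]
        exact Valuation.map_add_lt _ h1 h2
      map_smul' := by
        intro c x
        ext s
        have h1 := (hasValueAt_iff _ _ _).mp (hval x s (hsS s))
        refine HasValueAt.valueAt_eq ((hasValueAt_iff _ _ _).mpr ?_)
        rw [RingHom.id_apply, Pi.smul_apply, map_smul, smul_eq_mul, map_mul, Algebra.smul_def,
          ← mul_sub, ← Algebra.smul_def]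
        exact (ptVal_smul_le _ _ _).trans_lt h1 }
  have hcardT : Fintype.card (punctured S P) + 1 = S.card := by
    rw [Fintype.card_coe, ← Finset.card_erase_add_one hP]
    congr 2
    ext s
    rw [mem_punctured, Finset.mem_erase]
  refine isMDS_of_card_zeros_lt e (by omega) fun x hx Z hZ => ?_
  have hlt := hS.card_zeros_lt hP (hmem x) (fun h => hx (hφ (by rw [h, map_zero])))
    (Z := Z.map (Function.Embedding.subtype _)) ?_ ?_
  · rw [Finset.card_map] at hlt
    omega
  · intro s hs
    rw [Finset.mem_map] at hs
    obtain ⟨t, -, rfl⟩ := hs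
    exact Finset.mem_erase.mpr (mem_punctured.mp t.2)
  · intro s hs
    rw [Finset.mem_map] at hs
    obtain ⟨t, ht, rfl⟩ := hs
    have h1 : valueAt (t : W.toAffine.Point) (φ x) = 0 := hZ t ht
    have h2 := (hasValueAt_iff _ _ _).mp (hval x t (hsS t))
    rwa [h1, map_zero, sub_zero] at h2

omit [W.IsElliptic] in
theorem IsGeneric.notMem (hS : IsGeneric S Y) (hP : P ∈ S) : P ∉ Y :=
  Finset.disjoint_left.mp hS.disjoint hP

theorem IsGeneric.isMDS_code (hS : IsGeneric S Y) (hP : P ∈ S) (hQ : Q ∈ Y)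
    (hcard : Y.card < S.card) :
    IsMDS (code (pointsDivisor (Y : Set W.toAffine.Point)) S P) :=
  have := finiteDimensional_L0 hQ (hS.notMem hP)
  hS.isMDS_evaluation hP hcard (Submodule.subtype _) (Submodule.subtype_injective _)
    (fun x => x.2) (finrank_L0 hQ (hS.notMem hP))

theorem IsGeneric.isMDS_code_restrict {X : Finset W.toAffine.Point} (hS : IsGeneric S Y)
    (hP : P ∈ S) (hQ : Q ∈ Y) (hcard : Y.card < S.card) (hYX : Y ⊆ X) :
    IsMDS (fun x : (L0 (pointsDivisor (Y : Set W.toAffine.Point)) P).submoduleOf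
      (L0 (pointsDivisor (X : Set W.toAffine.Point)) P) =>
        code (pointsDivisor (X : Set W.toAffine.Point)) S P x) :=
  IsMDS.submoduleOf (L0_mono hYX P)
    (fun (f : W.toAffine.FunctionField) (s : punctured S P) => valueAt (s : W.toAffine.Point) f)
    (hS.isMDS_code hP hQ hcard)

end EvaluationCodes

/-! ### Existence of generic sets and of enough points. -/

section GenericSets

/-- In a large enough finite subset of a commutative group there is a subset of given size in which
no subset has one of finitely many given sizes and sums. -/
theorem exists_generic_finset {G κ : Type*} [AddCommGroup G] [DecidableEq G] [Fintype κ]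
    (Y : κ → Finset G) (hY : ∀ i, (Y i).Nonempty) (X B : Finset G) (m : ℕ)
    (hB : X.card + m + Fintype.card κ * 2 ^ m < B.card) :
    ∃ S : Finset G, S.card = m ∧ Disjoint S X ∧
      ∀ i, ∀ T ⊆ S, T.card = (Y i).card → ∑ t ∈ T, t ≠ ∑ y ∈ Y i, y := by
  induction m with
  | zero =>
    -- No `Y i` has size zero, so the empty subset is harmless.
    refine ⟨∅, rfl, Finset.disjoint_empty_left X, fun i T hT hcard => ?_⟩
    rw [Finset.subset_empty.mp hT, Finset.card_empty] at hcard
    exact absurd hcard.symm (hY i).card_pos.ne'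
  | succ m ih =>
    have hpow : Fintype.card κ * 2 ^ m ≤ Fintype.card κ * 2 ^ (m + 1) :=
      Nat.mul_le_mul_left _ (Nat.pow_le_pow_right two_pos (Nat.le_succ m))
    obtain ⟨S, hS, hSX, hsum⟩ := ih (by omega)
    -- A new point `s` can spoil genericity only by completing a subset of `S` to the sum of some `Y
    -- i`, which determines `s`. Ignoring the size condition leaves at most `|κ| 2 ^ m` such points.
    set bad : Finset G := (X ∪ S) ∪ (Finset.univ ×ˢ S.powerset).image
      (fun p : κ × Finset G => ∑ y ∈ Y p.1, y - ∑ t ∈ p.2, t) with hbad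
    have hcard : bad.card < B.card := by
      have h1 : ((Finset.univ ×ˢ S.powerset).image
          (fun p : κ × Finset G => ∑ y ∈ Y p.1, y - ∑ t ∈ p.2, t)).card ≤
          Fintype.card κ * 2 ^ m := by
        refine Finset.card_image_le.trans ?_
        rw [Finset.card_product, Finset.card_powerset, hS, Finset.card_univ]
      have h2 := Finset.card_union_le X S
      have h3 := Finset.card_union_le (X ∪ S) ((Finset.univ ×ˢ S.powerset).image
        (fun p : κ × Finset G => ∑ y ∈ Y p.1, y - ∑ t ∈ p.2, t))
      rw [← hbad] at h3
      omega
    obtain ⟨s, -, hs⟩ := Finset.exists_mem_notMem_of_card_lt_card hcard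
    simp only [hbad, Finset.mem_union, Finset.mem_image, not_or, not_exists, not_and] at hs
    obtain ⟨⟨hsX, hsS⟩, hsbad⟩ := hs
    refine ⟨insert s S, by rw [Finset.card_insert_of_notMem hsS, hS],
      Finset.disjoint_insert_left.mpr ⟨hsX, hSX⟩, fun i T hT hTcard hTsum => ?_⟩
    by_cases hsT : s ∈ T
    · refine hsbad (i, T.erase s) ?_ ?_
      · rw [Finset.mem_product]
        exact ⟨Finset.mem_univ _, Finset.mem_powerset.mpr (Finset.subset_insert_iff.mp hT)⟩
      · change ∑ y ∈ Y i, y - ∑ t ∈ T.erase s, t = s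
        rw [← hTsum, ← Finset.add_sum_erase T _ hsT, add_sub_cancel_right]
    · exact hsum i T ((Finset.subset_insert_iff_of_notMem hsT).mp hT) hTcard hTsum

/-- An elliptic curve has arbitrarily many points over finite extensions. -/
theorem exists_extension_card_lt {k : Type u} [Field k] (E : WeierstrassCurve k) [E.IsElliptic]
    (N : ℕ) : ∃ (k' : Type u) (_ : Field k') (_ : Algebra k k') (_ : FiniteDimensional k k')
      (B : Finset (E.map (algebraMap k k')).toAffine.Point), N < B.card := by
  classical
  let Ω := AlgebraicClosure k
  have : Infinite Ω := IsAlgClosed.instInfinite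
  -- Over the algebraic closure each of these `N + 1` values of `x` admits a `y`, a root of a monic
  -- quadratic. Finitely many coordinates generate a finite extension, and distinct `x` give
  -- distinct points.
  obtain ⟨s, hs⟩ := Infinite.exists_subset_card_eq Ω (N + 1)
  have hroot : ∀ x : Ω, ∃ y : Ω, (E.map (algebraMap k Ω)).toAffine.Equation x y := by
    intro x
    let p : Polynomial Ω := Polynomial.C 1 * Polynomial.X ^ 2 +
      Polynomial.C (algebraMap k Ω E.a₁ * x + algebraMap k Ω E.a₃) * Polynomial.X +
      Polynomial.C (-(x ^ 3 + algebraMap k Ω E.a₂ * x ^ 2 + algebraMap k Ω E.a₄ * x +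
        algebraMap k Ω E.a₆))
    obtain ⟨y, hy⟩ := IsAlgClosed.exists_root p (by
      rw [Polynomial.degree_quadratic one_ne_zero]
      norm_num)
    refine ⟨y, ?_⟩
    rw [Affine.equation_iff]
    simp only [map_a₁, map_a₂, map_a₃, map_a₄, map_a₆]
    simp only [p, Polynomial.IsRoot, Polynomial.eval_add, Polynomial.eval_mul, Polynomial.eval_C,
      Polynomial.eval_pow, Polynomial.eval_X] at hy
    linear_combination hy
  choose y hy using hroot
  let k' : IntermediateField k Ω := IntermediateField.adjoin k ((s ∪ s.image y : Finset Ω) : Set Ω)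
  have hfd : FiniteDimensional k k' :=
    IntermediateField.finiteDimensional_adjoin fun x _ => Algebra.IsIntegral.isIntegral x
  have hx : ∀ x ∈ s, x ∈ k' := fun x hx =>
    IntermediateField.subset_adjoin _ _ (Finset.mem_union_left _ hx)
  have hyk : ∀ x ∈ s, y x ∈ k' := fun x hx =>
    IntermediateField.subset_adjoin _ _ (Finset.mem_union_right _ (Finset.mem_image_of_mem y hx))
  have heq : ∀ x (h : x ∈ s), (E.map (algebraMap k k')).toAffine.Nonsingular
      (⟨x, hx x h⟩ : k') (⟨y x, hyk x h⟩ : k') := by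
    intro x h
    rw [← Affine.equation_iff_nonsingular, Affine.equation_iff]
    have h1 := (Affine.equation_iff _ _).mp (hy x)
    simp only [map_a₁, map_a₂, map_a₃, map_a₄, map_a₆] at h1 ⊢
    exact Subtype.ext h1
  refine ⟨k', inferInstance, inferInstance, hfd,
    s.attach.image fun x => Affine.Point.some _ _ (heq x.1 x.2), ?_⟩
  rw [Finset.card_image_of_injective, Finset.card_attach, hs]
  · exact Nat.lt_succ_self N
  · intro a b hab
    have h1 := (Affine.Point.some.inj hab).1
    have h2 : (a : Ω) = b := congrArg (Subtype.val : k' → Ω) h1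
    exact Subtype.ext h2

end GenericSets

theorem inclusion_injective {k : Type*} [Field k] (E : WeierstrassCurve k) (k' : Type*) [Field k']
    [Algebra k k'] : Function.Injective (inclusion E k') := by
  rintro (_ | ⟨a, b, h⟩) (_ | ⟨a', b', h'⟩) heq
  · rfl
  · cases heq
  · cases heq
  · have h1 := Affine.Point.some.inj heq
    have h2 := (algebraMap k k').injective h1.1
    have h3 := (algebraMap k k').injective h1.2
    subst h2 h3
    rfl

theorem finite_point {k : Type*} [Field k] [Finite k] (E : WeierstrassCurve k) :
    Finite E.toAffine.Point := by
  let g : E.toAffine.Point → Option (k × k)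
    | .zero => none
    | .some a b _ => some (a, b)
  refine Finite.of_injective g ?_
  rintro (_ | ⟨a, b, h⟩) (_ | ⟨a', b', h'⟩) heq
  · rfl
  · cases heq
  · cases heq
  · simp only [g, Option.some.injEq, Prod.mk.injEq] at heq
    obtain ⟨rfl, rfl⟩ := heq
    rfl

end EllipticGoppa

end

/-! ### The theorem. -/

open EllipticGoppa
theorem theorem2p1 {k : Type u} [Field k] [Finite k] (E : WeierstrassCurve k) [E.IsElliptic]
    {ι : Type w} [Finite ι] [Nonempty ι] (X : ι → Set E.toAffine.Point)
    (Q : E.toAffine.Point) (hQ : ∀ i, Q ∈ X i) (hX : ∀ i j, i ≠ j → X i ∩ X j = {Q})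
    (m : ℕ) (hm : (⋃ i, X i).ncard < m) :
    ∃ (k' : Type u) (_ : Field k') (_ : Algebra k k') (_ : FiniteDimensional k k')
      (S : Finset (E.map (algebraMap k k')).toAffine.Point),
      S.card = m ∧
      Disjoint (S : Set (E.map (algebraMap k k')).toAffine.Point)
        (inclusion E k' '' ⋃ i, X i) ∧
      ∀ P ∈ S,
        IsMDS (code (pointsDivisor (inclusion E k' '' ⋃ i, X i)) S P) ∧
        (∀ i, IsMDS (code (pointsDivisor (inclusion E k' '' X i)) S P)) ∧
        (∀ i, L0 (pointsDivisor (inclusion E k' '' X i)) P ≤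
          L0 (pointsDivisor (inclusion E k' '' ⋃ i, X i)) P) ∧
        IsProperDecomposition (code (pointsDivisor (inclusion E k' '' ⋃ i, X i)) S P)
          (fun i => (L0 (pointsDivisor (inclusion E k' '' X i)) P).submoduleOf
            (L0 (pointsDivisor (inclusion E k' '' ⋃ i, X i)) P)) := by
  classical
  have := Fintype.ofFinite ι
  have := finite_point E
  -- `Option ι` indexes the sets to be treated: `none` stands for the union and `some i` for the
  -- `i`-th member. The first `m` bounds the size of the union in advance, before `k'` is known.
  obtain ⟨k', _, _, hfd, B, hB⟩ := exists_extension_card_lt E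
    (m + m + Fintype.card (Option ι) * 2 ^ m)
  have hfin : ∀ Z : Set E.toAffine.Point, (inclusion E k' '' Z).Finite :=
    fun Z => Z.toFinite.image _
  let YX := (hfin (⋃ i, X i)).toFinset
  let Y : ι → Finset (E.map (algebraMap k k')).toAffine.Point := fun i => (hfin (X i)).toFinset
  have hYX : (YX : Set (E.map (algebraMap k k')).toAffine.Point) = inclusion E k' '' ⋃ i, X i :=
    (hfin _).coe_toFinset
  have hY : ∀ i, (Y i : Set (E.map (algebraMap k k')).toAffine.Point) = inclusion E k' '' X i :=
    fun i => (hfin _).coe_toFinset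
  have hmem : ∀ A, A ∈ YX ↔ ∃ i, A ∈ Y i := by
    intro A
    rw [← Finset.mem_coe, hYX, Set.image_iUnion, Set.mem_iUnion]
    refine exists_congr fun i => ?_
    rw [← Finset.mem_coe, hY]
  have hsub : ∀ i, Y i ⊆ YX := fun i A hA => (hmem A).mpr ⟨i, hA⟩
  have hQY : ∀ i, inclusion E k' Q ∈ Y i := by
    intro i
    rw [← Finset.mem_coe, hY]
    exact Set.mem_image_of_mem _ (hQ i)
  have hQX : inclusion E k' Q ∈ YX := hsub (Classical.arbitrary ι) (hQY _)
  have hinter : ∀ i j, i ≠ j → ∀ A, A ∈ Y i → A ∈ Y j → A = inclusion E k' Q := by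
    intro i j hij A hi hj
    rw [← Finset.mem_coe, hY] at hi hj
    have h : A ∈ inclusion E k' '' (X i ∩ X j) := by
      rw [Set.image_inter (inclusion_injective E k')]
      exact ⟨hi, hj⟩
    rwa [hX i j hij, Set.image_singleton] at h
  have hcardX : YX.card < m := by
    rw [← Set.ncard_coe_finset, hYX]
    exact (Set.ncard_image_le (Set.toFinite _)).trans_lt hm
  obtain ⟨S, hS, hdisj, hsum⟩ := exists_generic_finset
    (fun o : Option ι => o.elim YX Y) (by
      rintro (_ | i)
      exacts [⟨_, hQX⟩, ⟨_, hQY i⟩]) YX B m (by omega)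
  refine ⟨k', _, _, hfd, S, hS, ?_, fun P hP => ?_⟩
  · rw [← hYX]
    exact Finset.disjoint_coe.mpr hdisj
  have hgX : IsGeneric S YX := ⟨hdisj, hsum none⟩
  have hgY : ∀ i, IsGeneric S (Y i) := fun i => ⟨hdisj.mono_right (hsub i), hsum (some i)⟩
  have hcX : YX.card < S.card := hS ▸ hcardX
  have hcY : ∀ i, (Y i).card < S.card := fun i => (Finset.card_le_card (hsub i)).trans_lt hcX
  have hMDS := hgX.isMDS_code hP hQX hcX
  have hfactor : (fun i => (L0 (pointsDivisor (inclusion E k' '' X i)) P).submoduleOf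
      (L0 (pointsDivisor (YX : Set (E.map (algebraMap k k')).toAffine.Point)) P)) =
      fun i => (L0 (pointsDivisor (Y i : Set (E.map (algebraMap k k')).toAffine.Point)) P).submoduleOf
        (L0 (pointsDivisor (YX : Set (E.map (algebraMap k k')).toAffine.Point)) P) :=
    funext fun i => by rw [hY]
  rw [← hYX, hfactor]
  refine ⟨hMDS, fun i => ?_, fun i => ?_, hMDS, ?_, fun i =>
    (hgY i).isMDS_code_restrict hP (hQY i) (hcY i) (hsub i)⟩
  · rw [← hY i]
    exact (hgY i).isMDS_code hP (hQY i) (hcY i)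
  · rw [← hY i]
    exact L0_mono (hsub i) P
  · convert isInternal_L0 hQY (hgX.notMem hP) hinter hmem
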